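/- **Setting.** Let $d\in\{2,3\}$, and let $\mathcal T_h$ be a conforming partition (no hanging nodes) of a polygonal/polyhedral domain $\Omega\subset\mathbb R^d$ into finitely many $d$-simplices $T$. It is called $\sigma$-shape-regular if every $T$ contains a ball of some diameter $\delta_T>0$ with $\operatorname{diam}T\le\sigma\,\delta_T$. Let $\mathcal E^o$ and $\mathcal E^\partial$ be the sets of interior and boundary faces, $\mathcal E^\partial=\mathcal E^D\cup\mathcal E^N$ any disjoint splitting into Dirichlet and Neumann faces (either may be empty), $h_E=\operatorname{diam}E$, and $P_E w=\frac1{|E|}\int_E w$. Fix a unit normal $n_E$ of each face, outward on $\partial\Omega$. On an interior face let $w^{+}$ ($w^-$) be the trace from the element for which $n_E$ points outward (inward), $[w]=w^+-w^-$, $\{w\}=\frac12(w^++w^-)$; on a boundary face $[w]=\{w\}=w$. Let $V^{DG}$ be the space of discontinuous piecewise affine scalar functions on $\mathcal T_h$, and $$V^{CR}=\{v\in V^{DG}: P_E[v]=0\ \ \forall E\in\mathcal E^o\cup\mathcal E^D\},\qquad \mathcal Z=\{z\in V^{DG}: P_E\{z\}=0\ \ \forall E\in\mathcal E^o\cup\mathcal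 E^N\};$$ bold letters denote the corresponding spaces of $\mathbb R^d$-valued functions (product spaces). For $\mu>0$, $\lambda\ge0$ let $\mathcal C A=2\mu A+\lambda\operatorname{tr}(A)I$, $\varepsilon(u)=\frac12(\nabla u+\nabla u^T)$, $\beta_0=d\lambda+2\mu$, $\beta_1=2\mu$, and for $\alpha_0>0$, $\alpha_1\ge0$ and $u,w\in\boldsymbol V^{DG}$ let $$\mathcal A_0(u,w)=\sum_{T}\int_T \mathcal C\varepsilon(u):\varepsilon(w)-\sum_{E\in\mathcal E^o\cup\mathcal E^D}\int_E\Big(\langle\{\mathcal C\varepsilon(u)n_E\},[w]\rangle+\langle[u],\{\mathcal C\varepsilon(w)n_E\}\rangle-\alpha_0\beta_0h_E^{-1}\langle [u],P_E[w]\rangle\Big),$$ $$\mathcal A(u,w)=\mathcal A_0(u,w)+\alpha_1\beta_1\sum_{E\in\mathcal E^o\cup\mathcal E^D}\int_E h_E^{-1}\langle[u],[w]\rangle .$$ Let $\mathrm{(J_\rho)}$ denote the property that for all $z\in\mathcal Z$ $$\sum_{E\in\mathcal E^o\cup\mathcal E^D}\|h_E^{-1/2}([z]-P_E[z])\|_{0,E}^2\le\Big(1-\frac1\rho\Big)\sum_{E\in\mathcal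 E^o\cup\mathcal E^D}\|h_E^{-1/2}[z]\|_{0,E}^2 .$$ **Lemma 4.1 (strengthened Cauchy–Schwarz inequality).** There is a function $\gamma=\gamma(\alpha_0,\alpha_1,\rho)$ with $0\le\gamma<1$ for all $\alpha_0>0$, $\alpha_1\ge0$, $\rho\ge1$, such that the following holds. For every $d\in\{2,3\}$ and $\sigma>0$ there are $\alpha_*>0$ and $\rho_*\ge1$, depending only on $d$ and $\sigma$, such that for every $\sigma$-shape-regular partition and every choice of Dirichlet faces: the property $\mathrm{(J_{\rho_*})}$ holds; and for all $\lambda\ge0$, $\mu>0$, $\alpha_1\ge 0$, all $\rho\ge1$ with $\mathrm{(J_\rho)}$, and all $\alpha_0>0$ that are large enough, in the sense that $\alpha_0\ge\alpha_*$ or just that $\mathcal A_0(u,u)\ge0$ for all $u\in\boldsymbol V^{DG}$, $$\mathcal A(z,v)^2\le\gamma(\alpha_0,\alpha_1,\rho)^2\,\mathcal A(z,z)\,\mathcal A(v,v)\qquad\text{for all } z\in\boldsymbol{\mathcal Z},\ v\in\boldsymbol V^{CR}.$$ In particular (taking $\rho=\rho_*$), for $\alpha_0\ge\alpha_*$ the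 constant is bounded away from $1$ independently of $h$, $\lambda$ and $\mu$. -/

import Mathlib

open MeasureTheory Geometry

noncomputable section

namespace ElasticityDG

abbrev Vec (d : ℕ) : Type := EuclideanSpace ℝ (Fin d)

/-- A conforming partition of a polygonal/polyhedral domain of `ℝ^d` into `d`-simplices: a finite
simplicial complex in which every simplex is contained in a `d`-simplex. The domain is (the interior
of) the underlying space of the complex. -/
structure Mesh (d : ℕ) where
  cplx : SimplicialComplex ℝ (Vec d)
  finite : cplx.faces.Finite
  pure : ∀ s ∈ cplx.faces, ∃ t ∈ cplx.faces, s ⊆ t ∧ t.card = d + 1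

namespace Mesh

variable {d : ℕ} (M : Mesh d)

open scoped Classical in
/-- The elements `T` of the mesh, each given by its `d + 1` vertices. -/
def elements : Finset (Finset (Vec d)) :=
  M.finite.toFinset.filter (fun s => s.card = d + 1)

open scoped Classical in
/-- The `(d-1)`-dimensional faces `E` of the mesh, each given by its `d` vertices. -/
def faces : Finset (Finset (Vec d)) :=
  M.finite.toFinset.filter (fun s => s.card = d)

open scoped Classical in
/-- The elements that have `F` as a face. -/
def adjacent (F : Finset (Vec d)) : Finset M.elements :=
  Finset.univ.filter (fun T => F ⊆ T.1)

open scoped Classical in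
/-- Faces shared by two elements. -/
def interiorFaces : Finset (Finset (Vec d)) :=
  M.faces.filter (fun F => (M.adjacent F).card = 2)

open scoped Classical in
/-- Faces that belong to one element only. -/
def boundaryFaces : Finset (Finset (Vec d)) :=
  M.faces.filter (fun F => (M.adjacent F).card = 1)

open scoped Classical in
/-- Interior faces together with the Dirichlet faces `D`. -/
def interiorOrDirichlet (D : Finset (Finset (Vec d))) : Finset (Finset (Vec d)) :=
  M.interiorFaces ∪ D

open scoped Classical in
/-- Interior faces together with the Neumann faces, which are the boundary faces not in `D`. -/
def interiorOrNeumann (D : Finset (Finset (Vec d))) : Finset (Finset (Vec d)) :=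
  M.interiorFaces ∪ (M.boundaryFaces \ D)

/-- Every element contains a ball of diameter `2 * r` with `diam T ≤ σ * (2 * r)`. -/
def ShapeRegular (σ : ℝ) : Prop :=
  ∀ T ∈ M.elements, ∃ (c : Vec d) (r : ℝ), 0 < r ∧
    Metric.closedBall c r ⊆ convexHull ℝ (T : Set (Vec d)) ∧
    Metric.diam (convexHull ℝ (T : Set (Vec d))) ≤ σ * (2 * r)

/-- `n` points out of the simplex `T` at its face `F` (`n` being normal to `F`). -/
def Outward (n : Vec d) (F T : Finset (Vec d)) : Prop :=
  ∀ x ∈ T, ∀ y ∈ F, inner ℝ n (x - y) ≤ 0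

/-- A fixed choice of unit normals `n_E` of the faces, outward on the boundary. -/
structure Normals where
  normal : Finset (Vec d) → Vec d
  norm_eq_one : ∀ F ∈ M.faces, ‖normal F‖ = 1
  orthogonal : ∀ F ∈ M.faces, ∀ x ∈ F, ∀ y ∈ F, inner ℝ (normal F) (x - y) = 0
  outward : ∀ F ∈ M.boundaryFaces, ∀ T ∈ M.adjacent F, Outward (normal F) F T.1

/-- Discontinuous piecewise affine functions with values in `X`: on each element an affine function,
and no relation between the elements. The trace on a face taken from within the element `T` is
the restriction of the affine function belonging to `T`. -/
abbrev DG (X : Type) [AddCommGroup X] [Module ℝ X] : Type :=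
  M.elements → (Vec d →ᵃ[ℝ] X)

end Mesh

section Faces

variable {d : ℕ}

/-- The `(d-1)`-dimensional surface measure on the face `F`. -/
def surf (F : Finset (Vec d)) : Measure (Vec d) :=
  (Measure.euclideanHausdorffMeasure (d - 1)).restrict (convexHull ℝ (F : Set (Vec d)))

/-- The size `h_E` of a face: its diameter. -/
def faceDiam (F : Finset (Vec d)) : ℝ := Metric.diam (convexHull ℝ (F : Set (Vec d)))

/-- The projection onto constants on the face `F`, that is the mean value over `F`. -/
def P0 {X : Type} [NormedAddCommGroup X] [NormedSpace ℝ X]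
    (F : Finset (Vec d)) (w : Vec d → X) : X :=
  ⨍ x, w x ∂(surf F)

end Faces

namespace Mesh

variable {d : ℕ} {M : Mesh d}

open scoped Classical in
/-- The elements adjacent to `F` for which `n_E` is the outward normal (there is exactly one). -/
def Normals.plus (N : M.Normals) (F : Finset (Vec d)) : Finset M.elements :=
  (M.adjacent F).filter (fun T => Outward (N.normal F) F T.1)

open scoped Classical in
/-- The elements adjacent to `F` for which `-n_E` is the outward normal (exactly one if `F` is an
interior face, none if `F` is a boundary face). -/
def Normals.minus (N : M.Normals) (F : Finset (Vec d)) : Finset M.elements :=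
  (M.adjacent F).filter (fun T => Outward (-N.normal F) F T.1)

/-- The jump on `F` of a quantity with the value `f T` from within `T`: `f⁺ - f⁻` on an interior
face, and the one-sided value on a boundary face. -/
def Normals.jump {X : Type} [AddCommGroup X] (N : M.Normals)
    (F : Finset (Vec d)) (f : M.elements → X) : X :=
  ∑ T ∈ N.plus F, f T - ∑ T ∈ N.minus F, f T

/-- The average on `F` of a quantity with the value `f T` from within `T`: `(f⁺ + f⁻) / 2` on an
interior face, and the one-sided value on a boundary face. -/
def avg {X : Type} [AddCommGroup X] [Module ℝ X] (M : Mesh d)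
    (F : Finset (Vec d)) (f : M.elements → X) : X :=
  ((M.adjacent F).card : ℝ)⁻¹ • ∑ T ∈ M.adjacent F, f T

/-- The Crouzeix–Raviart space (for `X = ℝ^d` it is the product of the scalar spaces). -/
def IsCR {X : Type} [NormedAddCommGroup X] [NormedSpace ℝ X] (N : M.Normals)
    (D : Finset (Finset (Vec d))) (v : M.DG X) : Prop :=
  ∀ F ∈ M.interiorOrDirichlet D, P0 F (fun x => N.jump F (fun T => v T x)) = 0

/-- The space `𝒵` complementary to the Crouzeix–Raviart space. -/
def IsZ {X : Type} [NormedAddCommGroup X] [NormedSpace ℝ X]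
    (D : Finset (Finset (Vec d))) (z : M.DG X) : Prop :=
  ∀ F ∈ M.interiorOrNeumann D, P0 F (fun x => M.avg F (fun T => z T x)) = 0

end Mesh

section Elasticity

variable {d : ℕ}

/-- The (constant) gradient `∂_j u_i` of an affine vector field. -/
def grad (u : Vec d →ᵃ[ℝ] Vec d) : Matrix (Fin d) (Fin d) ℝ :=
  Matrix.of fun i j => u.linear (EuclideanSpace.single j 1) i

/-- The symmetric gradient `ε(u)`. -/
def eps (u : Vec d →ᵃ[ℝ] Vec d) : Matrix (Fin d) (Fin d) ℝ :=
  (1 / 2 : ℝ) • (grad u + (grad u).transpose)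

/-- The Frobenius scalar product. -/
def frob (A B : Matrix (Fin d) (Fin d) ℝ) : ℝ := ∑ i, ∑ j, A i j * B i j

/-- The elasticity tensor `𝒞 A = 2 μ A + λ tr(A) I`. -/
def elast (lam mu : ℝ) (A : Matrix (Fin d) (Fin d) ℝ) : Matrix (Fin d) (Fin d) ℝ :=
  (2 * mu) • A + (lam * A.trace) • (1 : Matrix (Fin d) (Fin d) ℝ)

end Elasticity

namespace Mesh

variable {d : ℕ} {M : Mesh d}

/-- The average on `F` of the normal stress `𝒞 ε(u) n_E`. -/
def avgStress (N : M.Normals) (lam mu : ℝ) (F : Finset (Vec d)) (u : M.DG (Vec d)) : Vec d :=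
  M.avg F (fun T => Matrix.toEuclideanLin (elast lam mu (eps (u T))) (N.normal F))

/-- The penalty term `a_{j,0}`, with `β₀ = d λ + 2 μ`. -/
def penalty0 (N : M.Normals) (D : Finset (Finset (Vec d))) (lam mu α₀ : ℝ)
    (u w : M.DG (Vec d)) : ℝ :=
  α₀ * (d * lam + 2 * mu) * ∑ F ∈ M.interiorOrDirichlet D,
    ∫ x, inner ℝ ((faceDiam F)⁻¹ • N.jump F (fun T => u T x))
      (P0 F (fun y => N.jump F (fun T => w T y))) ∂(surf F)

/-- The penalty term `a_{j,1}`, with `β₁ = 2 μ`. -/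
def penalty1 (N : M.Normals) (D : Finset (Finset (Vec d))) (mu α₁ : ℝ)
    (u w : M.DG (Vec d)) : ℝ :=
  α₁ * (2 * mu) * ∑ F ∈ M.interiorOrDirichlet D,
    ∫ x, inner ℝ ((faceDiam F)⁻¹ • N.jump F (fun T => u T x))
      (N.jump F (fun T => w T x)) ∂(surf F)

/-- The bilinear form `𝒜₀` of the symmetric interior penalty method with reduced integration. -/
def formA0 (N : M.Normals) (D : Finset (Finset (Vec d))) (lam mu α₀ : ℝ)
    (u w : M.DG (Vec d)) : ℝ :=
  (∑ T : M.elements, ∫ _x in convexHull ℝ (T.1 : Set (Vec d)),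
      frob (elast lam mu (eps (u T))) (eps (w T)))
    - (∑ F ∈ M.interiorOrDirichlet D,
        ∫ x, inner ℝ (avgStress N lam mu F u) (N.jump F (fun T => w T x)) ∂(surf F))
    - (∑ F ∈ M.interiorOrDirichlet D,
        ∫ x, inner ℝ (N.jump F (fun T => u T x)) (avgStress N lam mu F w) ∂(surf F))
    + penalty0 N D lam mu α₀ u w

/-- The bilinear form `𝒜 = 𝒜₀ + a_{j,1}` of the symmetric interior penalty method. -/
def formA (N : M.Normals) (D : Finset (Finset (Vec d))) (lam mu α₀ α₁ : ℝ)
    (u w : M.DG (Vec d)) : ℝ :=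
  formA0 N D lam mu α₀ u w + penalty1 N D mu α₁ u w

/-- `ρ` is a constant for which
`∑_E ‖h_E^{-1/2} ([z] - P_E [z])‖²_E ≤ (1 - 1/ρ) ∑_E ‖h_E^{-1/2} [z]‖²_E`
for all scalar functions `z ∈ 𝒵`, `E` running over the interior and the Dirichlet faces. -/
def JumpEstimate (N : M.Normals) (D : Finset (Finset (Vec d))) (ρ : ℝ) : Prop :=
  ∀ z : M.DG ℝ, IsZ D z →
    ∑ F ∈ M.interiorOrDirichlet D, (faceDiam F)⁻¹ *
      ∫ x, (N.jump F (fun T => z T x) - P0 F (fun y => N.jump F (fun T => z T y))) ^ 2 ∂(surf F)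
    ≤ (1 - 1 / ρ) * ∑ F ∈ M.interiorOrDirichlet D, (faceDiam F)⁻¹ *
      ∫ x, (N.jump F (fun T => z T x)) ^ 2 ∂(surf F)

end Mesh

end ElasticityDG

end

noncomputable section

namespace ElasticityDG

open scoped Classical

variable {d : ℕ} {X : Type} [NormedAddCommGroup X] [NormedSpace ℝ X]

/-! The spaces 𝒵 and V^CR are orthogonal for 𝒜₀. Integrate 𝒞ε(v) : ε(z) by parts on each element.
The stress of v is constant there, so only the face means of z enter. The mean of {z} vanishes on
interior faces and that of z itself on Neumann faces, so what is left is exactly the consistency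
term with {𝒞ε(v)n} and [z]. The other consistency term and the reduced penalty see only P_E[v] = 0.
This is `formA0_eq_zero`.

Hence 𝒜(z,v) is the full penalty of z and v alone. Since [v] has mean zero on each face, [z] may be
replaced by [z] - P_E[z]. Cauchy–Schwarz and (J_ρ), applied to the components of z, give the factor
1 - 1/ρ (`penalty1_sq_le`). Finally the penalty is at most 𝒜 on the diagonal because 𝒜₀ ≥ 0. Thus γ
= √(1 - 1/ρ) works.

Two facts about shape-regular meshes remain. Nonnegativity of 𝒜₀ for large α₀ (`formA0_self_nonneg`)
is Young's inequality with the trace bound h_E |E| ≤ σ d |T|. The jump estimate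
(`jumpEstimate_of_shapeRegular`) holds because an affine function on a simplex is determined by its
face means, while the face means of z ∈ 𝒵 are controlled by the means of its jumps. So P_E[z]
controls all of [z].

The geometry rests on barycentric coordinates λ_a. Slicing the simplex parallel to a face gives |E|
= d |T| ‖∇λ_a‖, and a layer-cake integral on the face shows that P_E of an affine function is the
mean of its vertex values. Conformity enters through `Normals.sgn_injOn`: a face has at most one
element on each side. -/

/-- `T` is the vertex set of a nondegenerate `d`-simplex in `ℝ^d`. -/
structure IsSimplex (T : Finset (Vec d)) : Prop where
  indep : AffineIndependent ℝ ((↑) : T → Vec d)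
  card_eq : T.card = d + 1

/-- The vertices of a `d`-simplex as an affine basis. -/
def IsSimplex.basis {T : Finset (Vec d)} (hT : IsSimplex T) : AffineBasis T ℝ (Vec d) :=
  ⟨(↑), hT.indep, by
    rw [hT.indep.affineSpan_eq_top_iff_card_eq_finrank_add_one]
    simp [hT.card_eq]⟩

/-- The barycentric coordinate of a simplex `T` belonging to the vertex `a`. -/
def bary (T : Finset (Vec d)) (a : Vec d) : Vec d →ᵃ[ℝ] ℝ :=
  if h : IsSimplex T ∧ a ∈ T then h.1.basis.coord ⟨a, h.2⟩ else 0

/-! ### Barycentric coordinates and their gradients -/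

section Bary

variable {T : Finset (Vec d)} (hT : IsSimplex T)
include hT

theorem bary_eq_coord (a : T) : bary T a = hT.basis.coord a := by
  simp [bary, hT]

theorem bary_self {a : Vec d} (ha : a ∈ T) : bary T a a = 1 := by
  have := hT.basis.coord_apply_eq ⟨a, ha⟩
  rwa [← bary_eq_coord hT] at this

theorem bary_ne {a b : Vec d} (ha : a ∈ T) (hb : b ∈ T) (h : a ≠ b) : bary T a b = 0 := by
  have := hT.basis.coord_apply_ne (i := ⟨a, ha⟩) (j := ⟨b, hb⟩) (by simpa using h)
  rwa [← bary_eq_coord hT] at this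

theorem bary_apply {a b : Vec d} (ha : a ∈ T) (hb : b ∈ T) :
    bary T a b = if a = b then 1 else 0 := by
  split_ifs with h
  · subst h; exact bary_self hT ha
  · exact bary_ne hT ha hb h

theorem sum_bary (p : Vec d) : ∑ a ∈ T, bary T a p = 1 := by
  rw [← hT.basis.sum_coord_apply_eq_one p, ← Finset.sum_coe_sort]
  exact Finset.sum_congr rfl fun a _ => by rw [bary_eq_coord hT]

theorem sum_bary_smul (w : Vec d →ᵃ[ℝ] X) (p : Vec d) : ∑ a ∈ T, bary T a p • w a = w p := by
  have h : ∑ a : T, hT.basis.coord a p = 1 := hT.basis.sum_coord_apply_eq_one p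
  have key := Finset.univ.map_affineCombination hT.basis _ h w
  rw [hT.basis.affineCombination_coord_eq_self, Finset.affineCombination_eq_linear_combination _ _ _ h]
    at key
  rw [key, ← Finset.sum_coe_sort]
  exact Finset.sum_congr rfl fun a _ => by rw [bary_eq_coord hT]; rfl

theorem mem_convexHull_iff_bary {p : Vec d} :
    p ∈ convexHull ℝ (T : Set (Vec d)) ↔ ∀ a ∈ T, 0 ≤ bary T a p := by
  have h := hT.basis.convexHull_eq_nonneg_coord
  have hr : Set.range hT.basis = (T : Set (Vec d)) := by
    change Set.range ((↑) : T → Vec d) = _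
    simp
  rw [hr] at h
  rw [h]
  constructor
  · intro hp a ha
    have := hp ⟨a, ha⟩
    rwa [← bary_eq_coord hT] at this
  · intro hp a
    rw [← bary_eq_coord hT]
    exact hp a a.2

theorem mem_convexHull_erase_iff_bary {a p : Vec d} (ha : a ∈ T) :
    p ∈ convexHull ℝ ((T.erase a : Finset (Vec d)) : Set (Vec d)) ↔
      (∀ b ∈ T, 0 ≤ bary T b p) ∧ bary T a p = 0 := by
  constructor
  · intro hp
    refine ⟨(mem_convexHull_iff_bary hT).1
      (convexHull_mono (Finset.coe_subset.2 (Finset.erase_subset a T)) hp), ?_⟩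
    have hc : Convex ℝ {q : Vec d | bary T a q = 0} :=
      (convex_singleton (0 : ℝ)).affine_preimage (bary T a)
    refine convexHull_min (fun b hb => ?_) hc hp
    have hb' := Finset.mem_erase.1 (Finset.mem_coe.1 hb)
    exact bary_ne hT ha hb'.2 (Ne.symm hb'.1)
  · rintro ⟨h1, h2⟩
    have hs : ∑ b ∈ T.erase a, bary T b p = 1 := by
      rw [← sum_bary hT p, ← Finset.add_sum_erase T _ ha, h2, zero_add]
    have hp : p = ∑ b ∈ T.erase a, bary T b p • b := by
      have := sum_bary_smul hT (AffineMap.id ℝ (Vec d)) p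
      rw [← Finset.add_sum_erase T _ ha, h2] at this
      simpa using this.symm
    rw [hp]
    exact (convex_convexHull ℝ _).sum_mem (fun b hb => h1 b (Finset.mem_of_mem_erase hb)) hs
      fun b hb => subset_convexHull ℝ _ (Finset.mem_coe.2 hb)

theorem bary_le_one {a p : Vec d} (ha : a ∈ T) (hp : p ∈ convexHull ℝ (T : Set (Vec d))) :
    bary T a p ≤ 1 := by
  rw [← sum_bary hT p]
  exact Finset.single_le_sum (fun b hb => (mem_convexHull_iff_bary hT).1 hp b hb) ha

end Bary

/-- The gradient of the barycentric coordinate `bary T a`. -/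
def baryGrad (T : Finset (Vec d)) (a : Vec d) : Vec d :=
  (InnerProductSpace.toDual ℝ (Vec d)).symm (LinearMap.toContinuousLinearMap (bary T a).linear)

theorem inner_baryGrad (T : Finset (Vec d)) (a v : Vec d) :
    inner ℝ (baryGrad T a) v = (bary T a).linear v := by
  simp [baryGrad]

theorem inner_baryGrad_sub (T : Finset (Vec d)) (a p q : Vec d) :
    inner ℝ (baryGrad T a) (p - q) = bary T a p - bary T a q := by
  rw [inner_baryGrad]
  have := (bary T a).linearMap_vsub p q
  simpa using this

section Grad

variable {T : Finset (Vec d)} (hT : IsSimplex T)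
include hT

theorem sum_baryGrad : ∑ a ∈ T, baryGrad T a = 0 := by
  refine ext_inner_right ℝ fun v => ?_
  have h : ∀ a, inner ℝ (baryGrad T a) v = bary T a v - bary T a 0 := fun a => by
    rw [← inner_baryGrad_sub, sub_zero]
  rw [sum_inner, inner_zero_left]
  simp only [h, Finset.sum_sub_distrib, sum_bary hT, sub_self]

theorem linear_eq_sum_baryGrad (w : Vec d →ᵃ[ℝ] X) (v : Vec d) :
    w.linear v = ∑ a ∈ T, (inner ℝ (baryGrad T a) v : ℝ) • w a := by
  have h : w.linear v = w v - w 0 := by simpa using (w.linearMap_vsub v 0)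
  rw [h, ← sum_bary_smul hT w v, ← sum_bary_smul hT w 0, ← Finset.sum_sub_distrib]
  refine Finset.sum_congr rfl fun a _ => ?_
  rw [← sub_smul, ← inner_baryGrad_sub, sub_zero]

/-- The coordinate of a drops from 1 to 0 along the edge from a to b, so the edge is at least as
long as the height 1/‖∇λ_a‖. -/
theorem one_le_norm_baryGrad_mul {a b : Vec d} (ha : a ∈ T) (hb : b ∈ T) (hab : a ≠ b) :
    1 ≤ ‖baryGrad T a‖ * ‖a - b‖ := by
  have h := real_inner_le_norm (baryGrad T a) (a - b)
  rw [inner_baryGrad_sub, bary_self hT ha, bary_ne hT ha hb hab, sub_zero] at h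
  exact h

theorem exists_mem_ne (hd : 1 ≤ d) (a : Vec d) : ∃ b ∈ T, a ≠ b := by
  obtain ⟨b, hb, h⟩ := Finset.exists_mem_ne (by rw [hT.card_eq]; omega) a
  exact ⟨b, hb, h.symm⟩

theorem norm_baryGrad_pos (hd : 1 ≤ d) {a : Vec d} (ha : a ∈ T) : 0 < ‖baryGrad T a‖ := by
  obtain ⟨b, hb, hab⟩ := exists_mem_ne hT hd a
  have := one_le_norm_baryGrad_mul hT ha hb hab
  by_contra hn
  have h0 : ‖baryGrad T a‖ = 0 := le_antisymm (not_lt.1 hn) (norm_nonneg _)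
  rw [h0] at this
  linarith

end Grad

/-! ### Surface measure of a face, by homothetic slices -/

theorem isCompact_convexHull_finset (F : Finset (Vec d)) :
    IsCompact (convexHull ℝ (F : Set (Vec d))) :=
  F.finite_toSet.isCompact_convexHull (𝕜 := ℝ)

theorem measurableSet_convexHull_finset (F : Finset (Vec d)) :
    MeasurableSet (convexHull ℝ (F : Set (Vec d))) :=
  (isCompact_convexHull_finset F).isClosed.measurableSet

theorem lintegral_Ioo_pow (n : ℕ) :
    ∫⁻ x in Set.Ioo (0 : ℝ) 1, ENNReal.ofReal (x ^ n) = ENNReal.ofReal (((n : ℝ) + 1)⁻¹) := by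
  have h1 : ∫ x in Set.Ioo (0 : ℝ) 1, x ^ n = ((n : ℝ) + 1)⁻¹ := by
    rw [← integral_Ioc_eq_integral_Ioo, ← intervalIntegral.integral_of_le zero_le_one, integral_pow]
    simp
  rw [← h1, ofReal_integral_eq_lintegral_ofReal]
  · exact ((continuous_pow n).integrableOn_Icc).mono_set Set.Ioo_subset_Icc_self
  · filter_upwards [ae_restrict_mem measurableSet_Ioo] with x hx
    exact pow_nonneg hx.1.le n

theorem lintegral_Ioo_one_sub_pow (n : ℕ) :
    ∫⁻ x in Set.Ioo (0 : ℝ) 1, ENNReal.ofReal ((1 - x) ^ n) = ENNReal.ofReal (((n : ℝ) + 1)⁻¹) := by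
  have h1 : ∫ x in Set.Ioo (0 : ℝ) 1, (1 - x) ^ n = ((n : ℝ) + 1)⁻¹ := by
    rw [← integral_Ioc_eq_integral_Ioo, ← intervalIntegral.integral_of_le zero_le_one,
      intervalIntegral.integral_comp_sub_left (fun x => x ^ n) 1, integral_pow]
    simp
  rw [← h1, ofReal_integral_eq_lintegral_ofReal]
  · exact (Continuous.integrableOn_Icc (by fun_prop)).mono_set Set.Ioo_subset_Icc_self
  · filter_upwards [ae_restrict_mem measurableSet_Ioo] with x hx
    exact pow_nonneg (by linarith [hx.2]) n

theorem bary_homothety (T : Finset (Vec d)) (a b : Vec d) (c : ℝ) (p : Vec d) :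
    bary T b (AffineMap.homothety a c p) = c * (bary T b p - bary T b a) + bary T b a := by
  rw [AffineMap.homothety_eq_lineMap, AffineMap.apply_lineMap, AffineMap.lineMap_apply]
  simp

section FaceMeasure

variable {T : Finset (Vec d)} (hT : IsSimplex T)
include hT

/-- The slices of a simplex parallel to a face are homothetic to the face. -/
theorem slice_eq_homothety {a : Vec d} (ha : a ∈ T) {c : ℝ} (hc : 0 < c) (hc1 : c ≤ 1) :
    {p : Vec d | p ∈ convexHull ℝ (T : Set (Vec d)) ∧ bary T a p = 1 - c} =
      AffineMap.homothety a c '' convexHull ℝ ((T.erase a : Finset (Vec d)) : Set (Vec d)) := by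
  ext p
  constructor
  · rintro ⟨hp, hpa⟩
    rw [mem_convexHull_iff_bary hT] at hp
    refine ⟨AffineMap.homothety a c⁻¹ p, ?_, ?_⟩
    · rw [mem_convexHull_erase_iff_bary hT ha]
      have h0 : bary T a (AffineMap.homothety a c⁻¹ p) = 0 := by
        rw [bary_homothety, hpa, bary_self hT ha]; field_simp; ring
      refine ⟨fun b hb => ?_, h0⟩
      by_cases hba : b = a
      · rw [hba, h0]
      · rw [bary_homothety, bary_ne hT hb ha hba, sub_zero, add_zero]
        exact mul_nonneg (inv_nonneg.2 hc.le) (hp b hb)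
    · rw [← AffineMap.comp_apply, ← AffineMap.homothety_mul, mul_inv_cancel₀ hc.ne']
      simp
  · rintro ⟨q, hq, rfl⟩
    rw [mem_convexHull_erase_iff_bary hT ha] at hq
    have h0 : bary T a (AffineMap.homothety a c q) = 1 - c := by
      rw [bary_homothety, hq.2, bary_self hT ha]; ring
    refine ⟨(mem_convexHull_iff_bary hT).2 fun b hb => ?_, h0⟩
    by_cases hba : b = a
    · rw [hba, h0]; linarith
    · rw [bary_homothety, bary_ne hT hb ha hba, sub_zero, add_zero]
      exact mul_nonneg hc.le (hq.1 b hb)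

/-- The superlevel sets of a barycentric coordinate on a face are homothetic to the face. -/
theorem superlevel_eq_homothety {a b : Vec d} (ha : a ∈ T) (hb : b ∈ T) (hab : a ≠ b) {t : ℝ}
    (ht0 : 0 ≤ t) (ht : t < 1) :
    {p : Vec d | p ∈ convexHull ℝ ((T.erase a : Finset (Vec d)) : Set (Vec d)) ∧ t ≤ bary T b p} =
      AffineMap.homothety b (1 - t) ''
        convexHull ℝ ((T.erase a : Finset (Vec d)) : Set (Vec d)) := by
  have hc : 0 < 1 - t := by linarith
  ext p
  constructor
  · rintro ⟨hp, hpb⟩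
    rw [mem_convexHull_erase_iff_bary hT ha] at hp
    refine ⟨AffineMap.homothety b (1 - t)⁻¹ p, ?_, ?_⟩
    · rw [mem_convexHull_erase_iff_bary hT ha]
      refine ⟨fun e he => ?_, ?_⟩
      · by_cases heb : e = b
        · rw [heb, bary_homothety, bary_self hT hb]
          have : (1 - t)⁻¹ * (bary T b p - 1) + 1 = (1 - t)⁻¹ * (bary T b p - t) := by
            field_simp; ring
          rw [this]
          exact mul_nonneg (inv_nonneg.2 hc.le) (by linarith)
        · rw [bary_homothety, bary_ne hT he hb heb, sub_zero, add_zero]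
          exact mul_nonneg (inv_nonneg.2 hc.le) (hp.1 e he)
      · rw [bary_homothety, hp.2, bary_ne hT ha hb hab]; simp
    · rw [← AffineMap.comp_apply, ← AffineMap.homothety_mul, mul_inv_cancel₀ hc.ne']
      simp
  · rintro ⟨q, hq, rfl⟩
    rw [mem_convexHull_erase_iff_bary hT ha] at hq
    have h1 : t ≤ bary T b (AffineMap.homothety b (1 - t) q) := by
      rw [bary_homothety, bary_self hT hb]
      have := mul_nonneg hc.le (hq.1 b hb)
      linarith
    refine ⟨(mem_convexHull_erase_iff_bary hT ha).2 ⟨fun e he => ?_, ?_⟩, h1⟩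
    · by_cases heb : e = b
      · rw [heb]; linarith
      · rw [bary_homothety, bary_ne hT he hb heb, sub_zero, add_zero]
        exact mul_nonneg hc.le (hq.1 e he)
    · rw [bary_homothety, hq.2, bary_ne hT ha hb hab]; simp

open Measure in
/-- The volume of a simplex as a multiple of the measure of a face, in `ℝ≥0∞`. -/
theorem volume_simplex_eq (hd : 1 ≤ d) {a : Vec d} (ha : a ∈ T) :
    volume (convexHull ℝ (T : Set (Vec d))) =
      ENNReal.ofReal (‖baryGrad T a‖⁻¹ * (d : ℝ)⁻¹) *
        μHE[d - 1] (convexHull ℝ ((T.erase a : Finset (Vec d)) : Set (Vec d))) := by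
  set g := baryGrad T a with hg
  have hgp : 0 < ‖g‖ := norm_baryGrad_pos hT hd ha
  set K := convexHull ℝ (T : Set (Vec d))
  set KF := convexHull ℝ ((T.erase a : Finset (Vec d)) : Set (Vec d))
  -- The height vector from a to the opposite face plane: ⟨∇λ_a, v⟩ = -1, so the hyperplane through
  -- a + x v orthogonal to v is {λ_a = 1 - x}, and ‖v‖ is the height of the simplex.
  set v : Vec d := -((‖g‖ ^ 2)⁻¹ • g) with hv
  have hgv : inner ℝ g v = -1 := by
    rw [hv, inner_neg_right, inner_smul_right, real_inner_self_eq_norm_sq]; field_simp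
  have hv0 : v ≠ 0 := by
    intro h; rw [h, inner_zero_right] at hgv; norm_num at hgv
  have hvn : ‖v‖ = ‖g‖⁻¹ := by
    rw [hv, norm_neg, norm_smul, Real.norm_of_nonneg (by positivity)]; field_simp
  have hplane : ∀ (x : ℝ) (p : Vec d),
      p ∈ AffineSubspace.mk' (x • v +ᵥ a) (Submodule.span ℝ {v})ᗮ ↔ bary T a p = 1 - x := by
    intro x p
    rw [AffineSubspace.mem_mk', Submodule.mem_orthogonal_singleton_iff_inner_right]
    have h1 : inner ℝ g (p -ᵥ (x • v +ᵥ a)) = bary T a p - 1 + x := by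
      have : p -ᵥ (x • v +ᵥ a) = (p - a) - x • v := by
        simp only [vsub_eq_sub, vadd_eq_add]; abel
      rw [this, inner_sub_right, inner_smul_right, hgv, hg, inner_baryGrad_sub, bary_self hT ha]
      ring
    have h2 : inner ℝ v (p -ᵥ (x • v +ᵥ a)) = -((‖g‖ ^ 2)⁻¹ * (bary T a p - 1 + x)) := by
      rw [← h1]
      conv_lhs => rw [hv]
      rw [inner_neg_left, real_inner_smul_left]
    rw [h2]
    constructor
    · intro h
      have : bary T a p - 1 + x = 0 := by
        rcases mul_eq_zero.1 (neg_eq_zero.1 h) with h | h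
        · exact absurd h (by positivity)
        · exact h
      linarith
    · intro h; rw [h]; ring
  have hmain := EuclideanGeometry.euclideanHausdorffMeasure_eq_lintegral a hv0
    (measurableSet_convexHull_finset T)
  rw [finrank_euclideanSpace_fin, EuclideanSpace.euclideanHausdorffMeasure_eq_volume] at hmain
  rw [hmain]
  -- The slice at x is the face scaled by x, of measure x^(d-1) |E|. The endpoints x = 0, 1 form a
  -- null set and are discarded.
  have hslice : ∀ᵐ x : ℝ, μHE[d - 1]
      (K ∩ AffineSubspace.mk' (x • v +ᵥ a) (Submodule.span ℝ {v})ᗮ) =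
      (Set.Ioo (0 : ℝ) 1).indicator (fun x => ENNReal.ofReal (x ^ (d - 1)) * μHE[d - 1] KF) x := by
    have hne : ∀ c : ℝ, ∀ᵐ x : ℝ, x ≠ c := fun c => by
      rw [ae_iff]; simp
    filter_upwards [hne 0, hne 1] with x hx0 hx1
    have hset : K ∩ AffineSubspace.mk' (x • v +ᵥ a) (Submodule.span ℝ {v})ᗮ =
        {p : Vec d | p ∈ K ∧ bary T a p = 1 - x} := by
      ext p
      simp only [Set.mem_inter_iff, SetLike.mem_coe, hplane]
      rfl
    rw [hset]
    by_cases hx : x ∈ Set.Ioo (0 : ℝ) 1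
    · rw [Set.indicator_of_mem hx, slice_eq_homothety hT ha hx.1 hx.2.le,
        euclideanHausdorffMeasure_homothety_image _ _ hx0, ENNReal.smul_def, smul_eq_mul]
      congr 1
      rw [ENNReal.ofReal, ENNReal.coe_inj]
      ext
      simp [abs_of_pos hx.1, max_eq_left (pow_nonneg hx.1.le (d - 1))]
    · rw [Set.indicator_of_notMem hx]
      have : {p : Vec d | p ∈ K ∧ bary T a p = 1 - x} = ∅ := by
        ext p
        simp only [Set.mem_empty_iff_false, iff_false]
        rintro ⟨hp, hpx⟩
        have h0 := (mem_convexHull_iff_bary hT).1 hp a ha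
        have h1 := bary_le_one hT ha hp
        refine hx ⟨lt_of_le_of_ne (by linarith) (Ne.symm hx0), lt_of_le_of_ne (by linarith) hx1⟩
      rw [this, measure_empty]
  rw [lintegral_congr_ae hslice, lintegral_indicator measurableSet_Ioo,
    lintegral_mul_const _ (by fun_prop), lintegral_Ioo_pow, ← mul_assoc]
  congr 1
  have hd' : ((d - 1 : ℕ) : ℝ) + 1 = d := by
    rw [Nat.cast_sub hd]; simp
  rw [hd', ENNReal.ofReal_mul (by positivity), ← hvn, ofReal_norm]

end FaceMeasure

/-! ### Volumes, areas, face means and shape regularity -/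

/-- The volume of the simplex with the vertices `T`. -/
def vol (T : Finset (Vec d)) : ℝ := volume.real (convexHull ℝ (T : Set (Vec d)))

/-- The surface measure of the face `F`. -/
def area (F : Finset (Vec d)) : ℝ := (surf F).real Set.univ

/-- The mean value over the vertices of the face `F` (for affine `w`, the mean over `F`). -/
def vmean (F : Finset (Vec d)) (w : Vec d → X) : X := (d : ℝ)⁻¹ • ∑ x ∈ F, w x

theorem vol_nonneg (T : Finset (Vec d)) : 0 ≤ vol T := measureReal_nonneg

theorem area_nonneg (F : Finset (Vec d)) : 0 ≤ area F := measureReal_nonneg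

theorem surf_univ (F : Finset (Vec d)) :
    surf F Set.univ = Measure.euclideanHausdorffMeasure (d - 1) (convexHull ℝ (F : Set (Vec d))) := by
  rw [surf, Measure.restrict_apply_univ]

theorem ae_surf_mem (F : Finset (Vec d)) :
    ∀ᵐ x ∂(surf F), x ∈ convexHull ℝ (F : Set (Vec d)) :=
  ae_restrict_mem (measurableSet_convexHull_finset F)

theorem faceDiam_le_diam (T : Finset (Vec d)) (a : Vec d) :
    faceDiam (T.erase a) ≤ Metric.diam (convexHull ℝ (T : Set (Vec d))) :=
  Metric.diam_mono (convexHull_mono (Finset.coe_subset.2 (Finset.erase_subset a T)))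
    (isCompact_convexHull_finset T).isBounded

section Simplex

variable {T : Finset (Vec d)} (hT : IsSimplex T)
include hT

theorem IsSimplex.vol_pos : 0 < vol T := by
  refine ENNReal.toReal_pos ?_ (isCompact_convexHull_finset T).measure_lt_top.ne
  have hr : Set.range hT.basis = (T : Set (Vec d)) := by
    change Set.range ((↑) : T → Vec d) = _
    simp
  have h : (interior (convexHull ℝ (T : Set (Vec d)))).Nonempty := by
    rw [← hr]
    exact ⟨_, hT.basis.centroid_mem_interior_convexHull⟩
  exact (Measure.measure_pos_of_nonempty_interior volume h).ne'

/-- In the slicing formula a face of infinite measure would force the compact simplex to have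
infinite volume. -/
theorem surf_univ_lt_top (hd : 1 ≤ d) {a : Vec d} (ha : a ∈ T) :
    surf (T.erase a) Set.univ < ⊤ := by
  rw [surf_univ]
  by_contra hn
  have htop := not_lt_top_iff.1 hn
  have h := volume_simplex_eq hT hd ha
  have hpos : 0 < ‖baryGrad T a‖⁻¹ * (d : ℝ)⁻¹ := by
    have := norm_baryGrad_pos hT hd ha
    have : (0 : ℝ) < d := by exact_mod_cast hd
    positivity
  rw [htop, ENNReal.mul_top (ENNReal.ofReal_pos.2 hpos).ne'] at h
  exact (isCompact_convexHull_finset T).measure_lt_top.ne h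

theorem isFiniteMeasure_surf (hd : 1 ≤ d) {a : Vec d} (ha : a ∈ T) :
    IsFiniteMeasure (surf (T.erase a)) := ⟨surf_univ_lt_top hT hd ha⟩

/-- Volume is base times height over d, with height 1/‖∇λ_a‖. -/
theorem area_erase (hd : 1 ≤ d) {a : Vec d} (ha : a ∈ T) :
    area (T.erase a) = d * vol T * ‖baryGrad T a‖ := by
  have hg := norm_baryGrad_pos hT hd ha
  have hd' : (0 : ℝ) < d := by exact_mod_cast hd
  have h := congrArg ENNReal.toReal (volume_simplex_eq hT hd ha)
  rw [ENNReal.toReal_mul, ENNReal.toReal_ofReal (by positivity), ← surf_univ] at h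
  change vol T = _ * area (T.erase a) at h
  rw [h]
  field_simp

theorem area_erase_pos (hd : 1 ≤ d) {a : Vec d} (ha : a ∈ T) : 0 < area (T.erase a) := by
  have hg := norm_baryGrad_pos hT hd ha
  have hd' : (0 : ℝ) < d := by exact_mod_cast hd
  have hv := hT.vol_pos
  rw [area_erase hT hd ha]
  positivity

theorem integrable_surf_of_continuous (hd : 1 ≤ d) {a : Vec d} (ha : a ∈ T) {Y : Type*}
    [NormedAddCommGroup Y] {f : Vec d → Y} (hf : Continuous f) : Integrable f (surf (T.erase a)) := by
  have := isFiniteMeasure_surf hT hd ha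
  have hK := isCompact_convexHull_finset (T.erase a)
  obtain ⟨C, hC⟩ := hK.exists_bound_of_continuousOn hf.continuousOn
  refine Integrable.of_bound (hf.aestronglyMeasurable) C ?_
  filter_upwards [ae_surf_mem (T.erase a)] with x hx using hC x hx

-- Layer cake: for 0 < t < 1 the set {λ_b ≥ t} in the face is the face shrunk towards b by the
-- factor 1 - t, so its measure is (1 - t)^(d-1) |E|, and integrating over t gives |E|/d.
open Measure in
theorem integral_surf_bary (hd : 1 ≤ d) {a b : Vec d} (ha : a ∈ T) (hb : b ∈ T.erase a) :
    ∫ x, bary T b x ∂(surf (T.erase a)) = (d : ℝ)⁻¹ * area (T.erase a) := by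
  obtain ⟨hba, hbT⟩ := Finset.mem_erase.1 hb
  have hcont : Continuous (bary T b) := (bary T b).continuous_of_finiteDimensional
  have hnn : 0 ≤ᵐ[surf (T.erase a)] fun x => bary T b x := by
    filter_upwards [ae_surf_mem (T.erase a)] with x hx
    exact ((mem_convexHull_erase_iff_bary hT ha).1 hx).1 b hbT
  rw [integral_eq_lintegral_of_nonneg_ae hnn hcont.aestronglyMeasurable,
    lintegral_eq_lintegral_meas_le _ hnn hcont.aemeasurable]
  set KF := convexHull ℝ ((T.erase a : Finset (Vec d)) : Set (Vec d))
  have hm : ∀ᵐ t ∂(volume.restrict (Set.Ioi (0 : ℝ))),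
      surf (T.erase a) {x | t ≤ bary T b x} =
      (Set.Ioo (0 : ℝ) 1).indicator
        (fun t => ENNReal.ofReal ((1 - t) ^ (d - 1)) * μHE[d - 1] KF) t := by
    have hne : ∀ᵐ x : ℝ ∂(volume.restrict (Set.Ioi (0 : ℝ))), x ≠ 1 :=
      ae_restrict_of_ae (by rw [ae_iff]; simp)
    filter_upwards [hne, ae_restrict_mem measurableSet_Ioi] with t ht1 ht0
    have ht0' : 0 < t := ht0
    have hset : surf (T.erase a) {x | t ≤ bary T b x} =
        μHE[d - 1] {p : Vec d | p ∈ KF ∧ t ≤ bary T b p} := by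
      rw [surf, Measure.restrict_apply (measurableSet_le measurable_const hcont.measurable)]
      congr 1
      ext p
      exact and_comm
    rw [hset]
    by_cases ht : t < 1
    · have hc : 0 < 1 - t := by linarith
      rw [Set.indicator_of_mem (Set.mem_Ioo.2 ⟨ht0', ht⟩),
        superlevel_eq_homothety hT ha hbT (Ne.symm hba) ht0'.le ht,
        euclideanHausdorffMeasure_homothety_image _ _ hc.ne', ENNReal.smul_def, smul_eq_mul]
      congr 1
      rw [ENNReal.ofReal, ENNReal.coe_inj]
      ext
      simp [abs_of_pos hc, max_eq_left (pow_nonneg hc.le (d - 1))]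
    · rw [Set.indicator_of_notMem (fun h => ht h.2)]
      have : {p : Vec d | p ∈ KF ∧ t ≤ bary T b p} = ∅ := by
        ext p
        simp only [Set.mem_empty_iff_false, iff_false]
        rintro ⟨hp, hpt⟩
        have h1 := bary_le_one hT hbT
          (convexHull_mono (Finset.coe_subset.2 (Finset.erase_subset a T)) hp)
        exact ht1 (le_antisymm (by linarith) (not_lt.1 ht))
      rw [this, measure_empty]
  rw [lintegral_congr_ae hm, lintegral_indicator measurableSet_Ioo,
    Measure.restrict_restrict measurableSet_Ioo,
    Set.inter_eq_left.2 Set.Ioo_subset_Ioi_self,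
    lintegral_mul_const _ (by fun_prop), lintegral_Ioo_one_sub_pow, ENNReal.toReal_mul,
    ENNReal.toReal_ofReal (by positivity), ← surf_univ]
  have hd' : ((d - 1 : ℕ) : ℝ) + 1 = d := by
    rw [Nat.cast_sub hd]; simp
  rw [hd']
  rfl

theorem integral_surf_affine [CompleteSpace X] (hd : 1 ≤ d) {a : Vec d} (ha : a ∈ T)
    (w : Vec d →ᵃ[ℝ] X) :
    ∫ x, w x ∂(surf (T.erase a)) = area (T.erase a) • vmean (T.erase a) w := by
  have h1 : ∫ x, w x ∂(surf (T.erase a)) =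
      ∫ x, ∑ b ∈ T.erase a, bary T b x • w b ∂(surf (T.erase a)) := by
    refine integral_congr_ae ?_
    filter_upwards [ae_surf_mem (T.erase a)] with x hx
    have := ((mem_convexHull_erase_iff_bary hT ha).1 hx).2
    rw [← sum_bary_smul hT w x, ← Finset.add_sum_erase T _ ha, this, zero_smul, zero_add]
  rw [h1, integral_finsetSum]
  · simp_rw [integral_smul_const]
    rw [vmean, smul_smul, Finset.smul_sum]
    exact Finset.sum_congr rfl fun b hb => by rw [integral_surf_bary hT hd ha hb, mul_comm]
  · intro b _
    exact integrable_surf_of_continuous hT hd ha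
      ((bary T b).continuous_of_finiteDimensional.smul continuous_const)

theorem P0_affine [CompleteSpace X] (hd : 1 ≤ d) {a : Vec d} (ha : a ∈ T)
    (w : Vec d →ᵃ[ℝ] X) : P0 (T.erase a) w = vmean (T.erase a) w := by
  rw [P0, average_eq, integral_surf_affine hT hd ha, smul_smul]
  change ((area (T.erase a))⁻¹ * area (T.erase a)) • _ = _
  rw [inv_mul_cancel₀ (area_erase_pos hT hd ha).ne', one_smul]

theorem card_erase_eq {a : Vec d} (ha : a ∈ T) : (T.erase a).card = d := by
  rw [Finset.card_erase_of_mem ha, hT.card_eq]; rfl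

/-- The values of an affine function at the vertices of a simplex, in terms of its means over the
faces. -/
theorem affine_eq_sum_vmean (hd : 1 ≤ d) (w : Vec d →ᵃ[ℝ] X) {y : Vec d} (hy : y ∈ T) :
    w y = ∑ a ∈ T, (if a = y then 1 - (d : ℝ) else 1) • vmean (T.erase a) w := by
  have hd' : (d : ℝ) ≠ 0 := by
    have : (0 : ℝ) < d := by exact_mod_cast hd
    exact this.ne'
  -- With S the sum of the vertex values, the mean opposite to a is (S - w a)/d, and all d + 1 means
  -- add up to S. Hence w y is S minus d times the mean opposite to y.
  have hm : ∀ a ∈ T, vmean (T.erase a) w = (d : ℝ)⁻¹ • (∑ x ∈ T, w x - w a) := by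
    intro a ha
    rw [vmean, ← Finset.add_sum_erase T _ ha, add_sub_cancel_left]
  have hsum : ∑ a ∈ T, vmean (T.erase a) w = ∑ x ∈ T, w x := by
    rw [Finset.sum_congr rfl hm, ← Finset.smul_sum, Finset.sum_sub_distrib, Finset.sum_const,
      hT.card_eq, ← Nat.cast_smul_eq_nsmul ℝ]
    push_cast
    rw [add_smul, one_smul, add_sub_cancel_right, smul_smul, inv_mul_cancel₀ hd', one_smul]
  have hsplit : ∀ a ∈ T, (if a = y then 1 - (d : ℝ) else 1) • vmean (T.erase a) w =
      vmean (T.erase a) w - (if a = y then (d : ℝ) • vmean (T.erase a) w else 0) := by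
    intro a _
    split_ifs
    · rw [sub_smul, one_smul]
    · simp
  rw [Finset.sum_congr rfl hsplit, Finset.sum_sub_distrib, hsum, Finset.sum_ite_eq' T y, if_pos hy,
    hm y hy, smul_smul, mul_inv_cancel₀ hd', one_smul, sub_sub_cancel]

/-- Across the diameter of the ball in the direction of ∇λ_a the coordinate grows by 2r‖∇λ_a‖, while
it stays in [0,1] on the simplex. -/
theorem baryGrad_mul_le_one {a c : Vec d} (ha : a ∈ T) {r : ℝ} (hr : 0 < r)
    (hball : Metric.closedBall c r ⊆ convexHull ℝ (T : Set (Vec d))) :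
    ‖baryGrad T a‖ * (2 * r) ≤ 1 := by
  set g := baryGrad T a with hg
  by_cases h0 : ‖g‖ = 0
  · rw [h0]; norm_num
  set e : Vec d := (r * ‖g‖⁻¹) • g with he
  have hen : ‖e‖ = r := by
    rw [he, norm_smul, Real.norm_of_nonneg (by positivity)]; field_simp
  have h1 : c + e ∈ convexHull ℝ (T : Set (Vec d)) := hball (by simp [hen])
  have h2 : c - e ∈ convexHull ℝ (T : Set (Vec d)) := hball (by simp [hen])
  have h3 := bary_le_one hT ha h1
  have h4 := (mem_convexHull_iff_bary hT).1 h2 a ha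
  have h5 := inner_baryGrad_sub T a (c + e) (c - e)
  have h6 : (c + e) - (c - e) = (2 * (r * ‖g‖⁻¹)) • g := by
    rw [mul_smul, ← he, two_smul]; abel
  rw [h6, inner_smul_right, ← hg, real_inner_self_eq_norm_sq] at h5
  have h7 : 2 * (r * ‖g‖⁻¹) * ‖g‖ ^ 2 = ‖g‖ * (2 * r) := by field_simp
  linarith

theorem one_le_baryGrad_mul_diam (hd : 1 ≤ d) {a : Vec d} (ha : a ∈ T) :
    1 ≤ ‖baryGrad T a‖ * Metric.diam (convexHull ℝ (T : Set (Vec d))) := by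
  obtain ⟨b, hb, hab⟩ := exists_mem_ne hT hd a
  refine (one_le_norm_baryGrad_mul hT ha hb hab).trans
    (mul_le_mul_of_nonneg_left ?_ (norm_nonneg _))
  rw [← dist_eq_norm]
  exact Metric.dist_le_diam_of_mem (isCompact_convexHull_finset T).isBounded
    (subset_convexHull ℝ _ (Finset.mem_coe.2 ha)) (subset_convexHull ℝ _ (Finset.mem_coe.2 hb))

/-- For d ≥ 2 a face has two vertices. Their distance is at least a height of the simplex, and no
height is below 2r. -/
theorem le_faceDiam (hd : 2 ≤ d) {a c : Vec d} (ha : a ∈ T) {r : ℝ} (hr : 0 < r)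
    (hball : Metric.closedBall c r ⊆ convexHull ℝ (T : Set (Vec d))) :
    2 * r ≤ faceDiam (T.erase a) := by
  obtain ⟨x, hx, y, hy, hxy⟩ := Finset.one_lt_card.1
    (show 1 < (T.erase a).card by rw [card_erase_eq hT ha]; omega)
  have hxT := Finset.mem_of_mem_erase hx
  have hyT := Finset.mem_of_mem_erase hy
  have h1 := one_le_norm_baryGrad_mul hT hxT hyT hxy
  have h2 := baryGrad_mul_le_one hT hxT hr hball
  have hg := norm_baryGrad_pos hT (by omega) hxT
  have h3 : 2 * r ≤ ‖x - y‖ := le_of_mul_le_mul_left (h2.trans h1) hg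
  rw [← dist_eq_norm] at h3
  exact h3.trans (Metric.dist_le_diam_of_mem (isCompact_convexHull_finset _).isBounded
    (subset_convexHull ℝ _ (Finset.mem_coe.2 hx)) (subset_convexHull ℝ _ (Finset.mem_coe.2 hy)))

variable {σ r : ℝ} {c : Vec d} (hd : 2 ≤ d) (hr : 0 < r)
  (hball : Metric.closedBall c r ⊆ convexHull ℝ (T : Set (Vec d)))
  (hdiam : Metric.diam (convexHull ℝ (T : Set (Vec d))) ≤ σ * (2 * r))
include hd hr hball hdiam

/-- The discrete trace inequality for constants: |E| = d |T| ‖∇λ_a‖, where ‖∇λ_a‖ ≤ 1/(2r) and h_E ≤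
diam T ≤ 2rσ. -/
theorem faceDiam_mul_area_le {a : Vec d} (ha : a ∈ T) :
    faceDiam (T.erase a) * area (T.erase a) ≤ σ * d * vol T := by
  have h1 := (faceDiam_le_diam T a).trans hdiam
  have h0 : 0 ≤ faceDiam (T.erase a) := Metric.diam_nonneg
  have hσ : 0 ≤ σ * (2 * r) := h0.trans h1
  have h2 := baryGrad_mul_le_one hT ha hr hball
  have hσ' : 0 ≤ σ := by
    by_contra hn
    have : σ * (2 * r) < 0 := mul_neg_of_neg_of_pos (not_le.1 hn) (by linarith)
    linarith
  rw [area_erase hT (by omega) ha]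
  have hv := vol_nonneg T
  have hdv : 0 ≤ (d : ℝ) * vol T := by positivity
  calc faceDiam (T.erase a) * (d * vol T * ‖baryGrad T a‖)
      ≤ (σ * (2 * r)) * (d * vol T * ‖baryGrad T a‖) :=
        mul_le_mul_of_nonneg_right h1 (by positivity)
    _ = (σ * (d * vol T)) * (‖baryGrad T a‖ * (2 * r)) := by ring
    _ ≤ (σ * (d * vol T)) * 1 := mul_le_mul_of_nonneg_left h2 (by positivity)
    _ = σ * d * vol T := by ring

/-- Divided by d |T|, the weights |E|/h_E of all faces of T lie between (diam T)⁻² and (2r)⁻², whose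
ratio is at most σ². -/
theorem inv_faceDiam_mul_area_le {a b : Vec d} (ha : a ∈ T) (hb : b ∈ T) :
    (faceDiam (T.erase a))⁻¹ * area (T.erase a) ≤
      σ ^ 2 * ((faceDiam (T.erase b))⁻¹ * area (T.erase b)) := by
  set D := Metric.diam (convexHull ℝ (T : Set (Vec d)))
  have hrr : 0 < 2 * r := by linarith
  have hFa := le_faceDiam hT hd ha hr hball
  have hFb := le_faceDiam hT hd hb hr hball
  have hFbD : faceDiam (T.erase b) ≤ D := faceDiam_le_diam T b
  have hD : 0 < D := by linarith
  have hga := baryGrad_mul_le_one hT ha hr hball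
  have hgb := one_le_baryGrad_mul_diam hT (by omega) hb
  have hv := hT.vol_pos
  have hdv : 0 ≤ (d : ℝ) * vol T := by positivity
  rw [area_erase hT (by omega) ha, area_erase hT (by omega) hb]
  have hFb0 : 0 < faceDiam (T.erase b) := by linarith
  have e1 : (faceDiam (T.erase a))⁻¹ ≤ (2 * r)⁻¹ := inv_anti₀ hrr hFa
  have e2 : ‖baryGrad T a‖ ≤ (2 * r)⁻¹ := by rwa [← one_div, le_div_iff₀ hrr]
  have e3 : D⁻¹ ≤ (faceDiam (T.erase b))⁻¹ := inv_anti₀ (by linarith) hFbD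
  have e4 : D⁻¹ ≤ ‖baryGrad T b‖ := by rwa [inv_le_iff_one_le_mul₀ hD]
  have e5 : (2 * r)⁻¹ ≤ σ * D⁻¹ := by
    rw [← div_eq_mul_inv, le_div_iff₀ hD, ← div_eq_inv_mul, div_le_iff₀ hrr]
    exact hdiam
  calc (faceDiam (T.erase a))⁻¹ * (d * vol T * ‖baryGrad T a‖)
      ≤ (2 * r)⁻¹ * (d * vol T * (2 * r)⁻¹) := by gcongr
    _ = (d * vol T) * ((2 * r)⁻¹) ^ 2 := by ring
    _ ≤ (d * vol T) * (σ * D⁻¹) ^ 2 := by gcongr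
    _ = σ ^ 2 * (D⁻¹ * (d * vol T * D⁻¹)) := by ring
    _ ≤ σ ^ 2 * ((faceDiam (T.erase b))⁻¹ * (d * vol T * ‖baryGrad T b‖)) := by gcongr

end Simplex

/-! ### Integration by parts on a simplex -/

section Gauss

variable {T : Finset (Vec d)} (hT : IsSimplex T)
include hT

/-- The gradient of w is the sum of the rank-one matrices w(a) ⊗ ∇λ_a. -/
theorem frob_grad_eq_sum (A : Matrix (Fin d) (Fin d) ℝ) (w : Vec d →ᵃ[ℝ] Vec d) :
    frob A (grad w) =
      ∑ a ∈ T, inner ℝ (Matrix.toEuclideanLin A (baryGrad T a)) (w a) := by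
  have h : ∀ i j, grad w i j = ∑ a ∈ T, baryGrad T a j * w a i := by
    intro i j
    rw [grad, Matrix.of_apply, linear_eq_sum_baryGrad hT]
    simp [EuclideanSpace.inner_single_right]
  simp only [frob, h, PiLp.inner_apply, Matrix.toLpLin_apply, Matrix.mulVec, dotProduct,
    RCLike.inner_apply, conj_trivial]
  simp only [Finset.mul_sum]
  symm
  rw [Finset.sum_comm]
  refine Finset.sum_congr rfl fun i _ => ?_
  rw [Finset.sum_comm]
  exact Finset.sum_congr rfl fun j _ => Finset.sum_congr rfl fun a _ => by ring

/-- The Gauss theorem on a simplex for an affine vector field. -/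
theorem vol_mul_frob_grad (hd : 1 ≤ d) (A : Matrix (Fin d) (Fin d) ℝ) (w : Vec d →ᵃ[ℝ] Vec d) :
    vol T * frob A (grad w) =
      ∑ a ∈ T, area (T.erase a) *
        inner ℝ (Matrix.toEuclideanLin A (-(‖baryGrad T a‖⁻¹ • baryGrad T a)))
          (vmean (T.erase a) w) := by
  have hd' : (d : ℝ) ≠ 0 := by
    have : (0 : ℝ) < d := by exact_mod_cast hd
    exact this.ne'
  -- The outward normal is -∇λ_a/‖∇λ_a‖, and its length cancels against the area. The part with the
  -- full vertex sum of w disappears on summation because the ∇λ_a add up to 0.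
  have h : ∀ a ∈ T, area (T.erase a) *
        inner ℝ (Matrix.toEuclideanLin A (-(‖baryGrad T a‖⁻¹ • baryGrad T a)))
          (vmean (T.erase a) w) =
      vol T * inner ℝ (Matrix.toEuclideanLin A (baryGrad T a)) (w a) -
        vol T * inner ℝ (Matrix.toEuclideanLin A (baryGrad T a)) (∑ x ∈ T, w x) := by
    intro a ha
    have hg := (norm_baryGrad_pos hT hd ha).ne'
    have hs : ∑ x ∈ T.erase a, w x = ∑ x ∈ T, w x - w a := by
      rw [← Finset.add_sum_erase T _ ha, add_sub_cancel_left]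
    rw [area_erase hT hd ha, vmean, hs, map_neg, map_smul, inner_neg_left, real_inner_smul_left,
      real_inner_smul_right, inner_sub_right]
    field_simp
    ring
  rw [Finset.sum_congr rfl h, Finset.sum_sub_distrib, ← Finset.mul_sum, ← Finset.mul_sum,
    ← sum_inner, ← map_sum, sum_baryGrad hT, map_zero, inner_zero_left, frob_grad_eq_sum hT]
  ring

end Gauss

/-! ### Faces, adjacent elements and orientation -/

namespace Mesh

variable {M : Mesh d}

theorem mem_elements {T : Finset (Vec d)} :
    T ∈ M.elements ↔ T ∈ M.cplx.faces ∧ T.card = d + 1 := by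
  simp [elements]

theorem mem_faces {F : Finset (Vec d)} : F ∈ M.faces ↔ F ∈ M.cplx.faces ∧ F.card = d := by
  simp [faces]

theorem mem_adjacent {F : Finset (Vec d)} {T : M.elements} : T ∈ M.adjacent F ↔ F ⊆ T.1 := by
  simp [adjacent]

theorem isSimplex (T : M.elements) : IsSimplex T.1 :=
  ⟨M.cplx.indep (mem_elements.1 T.2).1, (mem_elements.1 T.2).2⟩

theorem erase_mem_faces (hd : 1 ≤ d) (T : M.elements) {a : Vec d} (ha : a ∈ T.1) :
    T.1.erase a ∈ M.faces := by
  have hc := card_erase_eq (isSimplex T) ha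
  exact mem_faces.2 ⟨M.cplx.down_closed (mem_elements.1 T.2).1 (Finset.erase_subset _ _)
    (Finset.card_pos.1 (by omega)), hc⟩

theorem exists_eq_erase {F : Finset (Vec d)} (hF : F ∈ M.faces) {T : M.elements}
    (hT : T ∈ M.adjacent F) : ∃ a ∈ T.1, F = T.1.erase a := by
  have hs := mem_adjacent.1 hT
  have h1 := (mem_faces.1 hF).2
  have h2 := (isSimplex T).card_eq
  obtain ⟨a, ha, haF⟩ := Finset.exists_mem_notMem_of_card_lt_card (show F.card < T.1.card by omega)
  refine ⟨a, ha, Finset.eq_of_subset_of_card_le (fun x hx => ?_) ?_⟩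
  · exact Finset.mem_erase.2 ⟨fun h => haF (h ▸ hx), hs hx⟩
  · rw [card_erase_eq (isSimplex T) ha, h1]

theorem adjacent_nonempty {F : Finset (Vec d)} (hF : F ∈ M.faces) : (M.adjacent F).Nonempty := by
  obtain ⟨T, hT, hFT, hc⟩ := M.pure F (mem_faces.1 hF).1
  exact ⟨⟨T, mem_elements.2 ⟨hT, hc⟩⟩, mem_adjacent.2 hFT⟩

theorem exists_face_eq_erase {F : Finset (Vec d)} (hF : F ∈ M.faces) :
    ∃ T : M.elements, ∃ a ∈ T.1, F = T.1.erase a := by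
  obtain ⟨T, hT⟩ := adjacent_nonempty hF
  exact ⟨T, exists_eq_erase hF hT⟩

/-- Summation over the faces of the elements is summation over the elements adjacent to faces. -/
theorem sum_elements_erase {Y : Type*} [AddCommMonoid Y] (hd : 1 ≤ d)
    (G : M.elements → Finset (Vec d) → Y) :
    ∑ T : M.elements, ∑ a ∈ T.1, G T (T.1.erase a) = ∑ F ∈ M.faces, ∑ T ∈ M.adjacent F, G T F := by
  have h : ∀ T : M.elements, ∑ a ∈ T.1, G T (T.1.erase a) =
      ∑ F ∈ M.faces.filter (fun F => F ⊆ T.1), G T F := by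
    intro T
    refine Finset.sum_bij (fun a _ => T.1.erase a) (fun a ha => ?_) (fun a ha b hb hab => ?_)
      (fun F hF => ?_) (fun _ _ => rfl)
    · exact Finset.mem_filter.2 ⟨erase_mem_faces hd T ha, Finset.erase_subset _ _⟩
    · exact Finset.erase_injOn T.1 ha hb hab
    · obtain ⟨hF1, hF2⟩ := Finset.mem_filter.1 hF
      obtain ⟨a, ha, h⟩ := exists_eq_erase hF1 (mem_adjacent.2 hF2)
      exact ⟨a, ha, h.symm⟩
  rw [Finset.sum_congr rfl fun T _ => h T]
  refine Finset.sum_comm' fun T F => ?_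
  simp [mem_adjacent, and_comm]

section Normals

variable (N : M.Normals)

theorem outward_smul_iff {T : Finset (Vec d)} (hT : IsSimplex T) (hd : 1 ≤ d) {a : Vec d}
    (ha : a ∈ T) (κ : ℝ) : Outward (κ • baryGrad T a) (T.erase a) T ↔ κ ≤ 0 := by
  have hF : ∀ y ∈ T.erase a, bary T a y = 0 := fun y hy =>
    bary_ne hT ha (Finset.mem_of_mem_erase hy) (Ne.symm (Finset.ne_of_mem_erase hy))
  constructor
  · intro h
    obtain ⟨b, hb, hab⟩ := exists_mem_ne hT hd a
    have hbF := Finset.mem_erase.2 ⟨Ne.symm hab, hb⟩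
    have := h a ha b hbF
    rw [real_inner_smul_left, inner_baryGrad_sub, hF b hbF, bary_self hT ha] at this
    linarith
  · intro h x hx y hy
    rw [real_inner_smul_left, inner_baryGrad_sub, hF y hy, bary_apply hT ha hx]
    split_ifs <;> linarith

/-- Expand v as the sum of ⟨∇λ_b, v⟩ (b - y) with y a vertex of the face. The normal annihilates b -
y for every b in the face, so only the term b = a survives in ⟨n, v⟩. -/
theorem Normals.exists_eq_smul (hd : 1 ≤ d) {T : M.elements} {a : Vec d} (ha : a ∈ T.1) :
    ∃ κ : ℝ, κ ≠ 0 ∧ N.normal (T.1.erase a) = κ • baryGrad T.1 a := by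
  have hF := erase_mem_faces hd T ha
  have hT := isSimplex T
  set n := N.normal (T.1.erase a) with hn
  obtain ⟨y, hy, hay⟩ := exists_mem_ne hT hd a
  have hyF : y ∈ T.1.erase a := Finset.mem_erase.2 ⟨Ne.symm hay, hy⟩
  have hn1 : n = (inner ℝ n (a - y) : ℝ) • baryGrad T.1 a := by
    refine ext_inner_right ℝ fun v => ?_
    have hw := linear_eq_sum_baryGrad hT (AffineMap.id ℝ (Vec d)) v
    have hz : ∑ b ∈ T.1, (inner ℝ (baryGrad T.1 b) v : ℝ) • y = 0 := by
      rw [← Finset.sum_smul, ← sum_inner, sum_baryGrad hT, inner_zero_left, zero_smul]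
    have hv : v = ∑ b ∈ T.1, (inner ℝ (baryGrad T.1 b) v : ℝ) • (b - y) := by
      simp only [smul_sub, Finset.sum_sub_distrib, hz, sub_zero]
      simpa using hw
    conv_lhs => rw [hv]
    rw [inner_sum, ← Finset.add_sum_erase _ _ ha, Finset.sum_eq_zero, add_zero,
      real_inner_smul_right, real_inner_smul_left, mul_comm]
    intro b hb
    rw [real_inner_smul_right, N.orthogonal _ hF b hb y hyF, mul_zero]
  refine ⟨_, fun h0 => ?_, hn1⟩
  have h1 := N.norm_eq_one _ hF
  rw [← hn, hn1, h0, zero_smul, norm_zero] at h1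
  exact zero_ne_one h1

/-- The sign that makes the normal of the face `F` outward with respect to `T`. -/
def Normals.sgn (F : Finset (Vec d)) (T : M.elements) : ℝ :=
  if Outward (N.normal F) F T.1 then 1 else -1

theorem Normals.sgn_cases (F : Finset (Vec d)) (T : M.elements) :
    N.sgn F T = 1 ∨ N.sgn F T = -1 := by
  unfold Normals.sgn
  split_ifs <;> simp

/-- As n is a nonzero multiple of ∇λ_a, exactly one of n and -n is outward, so the plus and minus
elements partition the adjacent ones. -/
theorem Normals.jump_eq_sum (hd : 1 ≤ d) {F : Finset (Vec d)} (hF : F ∈ M.faces)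
    {Y : Type} [AddCommGroup Y] [Module ℝ Y] (f : M.elements → Y) :
    N.jump F f = ∑ T ∈ M.adjacent F, N.sgn F T • f T := by
  have hm : N.minus F = (M.adjacent F).filter (fun T => ¬ Outward (N.normal F) F T.1) := by
    refine Finset.filter_congr fun T hT => ?_
    obtain ⟨a, ha, rfl⟩ := exists_eq_erase hF hT
    obtain ⟨κ, hκ, h⟩ := N.exists_eq_smul hd ha
    rw [h, ← neg_smul, outward_smul_iff (isSimplex T) hd ha, outward_smul_iff (isSimplex T) hd ha,
      not_le]
    constructor
    · intro h; exact lt_of_le_of_ne (by linarith) (Ne.symm hκ)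
    · intro h; linarith
  rw [Normals.jump, hm, Normals.plus, ← Finset.sum_filter_add_sum_filter_not (M.adjacent F)
    (fun T => Outward (N.normal F) F T.1) (fun T => N.sgn F T • f T), sub_eq_add_neg,
    ← Finset.sum_neg_distrib]
  congr 1
  · refine Finset.sum_congr rfl fun T hT => ?_
    rw [Normals.sgn, if_pos (Finset.mem_filter.1 hT).2, one_smul]
  · refine Finset.sum_congr rfl fun T hT => ?_
    rw [Normals.sgn, if_neg (Finset.mem_filter.1 hT).2, neg_smul, one_smul]

theorem Normals.sgn_smul_normal (hd : 1 ≤ d) {T : M.elements} {a : Vec d} (ha : a ∈ T.1) :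
    N.sgn (T.1.erase a) T • N.normal (T.1.erase a) =
      -(‖baryGrad T.1 a‖⁻¹ • baryGrad T.1 a) := by
  obtain ⟨κ, hκ, h⟩ := N.exists_eq_smul hd ha
  have hg := norm_baryGrad_pos (isSimplex T) hd ha
  have hn := N.norm_eq_one _ (erase_mem_faces hd T ha)
  rw [h, norm_smul, Real.norm_eq_abs] at hn
  have hk : |κ| = ‖baryGrad T.1 a‖⁻¹ := eq_inv_of_mul_eq_one_left hn
  rw [Normals.sgn, h, ← hk]
  by_cases h0 : κ ≤ 0
  · rw [if_pos ((outward_smul_iff (isSimplex T) hd ha κ).2 h0), abs_of_nonpos h0, one_smul,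
      neg_smul, neg_neg]
  · rw [if_neg (fun hh => h0 ((outward_smul_iff (isSimplex T) hd ha κ).1 hh)),
      abs_of_pos (not_le.1 h0), neg_smul, one_smul]

/-- Two different elements adjacent to a face lie on different sides of it. -/
theorem Normals.sgn_injOn (hd : 1 ≤ d) {F : Finset (Vec d)} (hF : F ∈ M.faces) :
    Set.InjOn (N.sgn F) (M.adjacent F) := by
  intro T hT T' hT' hs
  by_contra hne
  have hS := isSimplex T
  have hS' := isSimplex T'
  obtain ⟨a, ha, hFa⟩ := exists_eq_erase hF hT
  obtain ⟨b, hb, hFb⟩ := exists_eq_erase hF hT'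
  have e1 := N.sgn_smul_normal hd ha
  have e2 := N.sgn_smul_normal hd hb
  rw [← hFa] at e1
  rw [← hFb, ← hs, e1, neg_inj] at e2
  have hg := norm_baryGrad_pos hS hd ha
  have hg' := norm_baryGrad_pos hS' hd hb
  have hFne : F.Nonempty := Finset.card_pos.1 (by rw [(mem_faces.1 hF).2]; omega)
  obtain ⟨y, hy⟩ := hFne
  have hlamF : ∀ x ∈ F, bary T.1 a x = 0 := fun x hx => by
    rw [hFa] at hx
    exact bary_ne hS ha (Finset.mem_of_mem_erase hx) (Ne.symm (Finset.ne_of_mem_erase hx))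
  have hlamF' : ∀ x ∈ F, bary T'.1 b x = 0 := fun x hx => by
    rw [hFb] at hx
    exact bary_ne hS' hb (Finset.mem_of_mem_erase hx) (Ne.symm (Finset.ne_of_mem_erase hx))
  -- Equal signs make ∇λ_a on T and ∇λ_b on T' positive multiples of each other, so b lies strictly
  -- on the same side of the face as a.
  have hpos : 0 < bary T.1 a b := by
    have h3 := congrArg (fun v => (inner ℝ v (b - y) : ℝ)) e2
    simp only [real_inner_smul_left, inner_baryGrad_sub, hlamF y hy, hlamF' y hy,
      bary_self hS' hb, sub_zero, mul_one] at h3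
    have : 0 < ‖baryGrad T.1 a‖⁻¹ * bary T.1 a b := h3 ▸ inv_pos.2 hg'
    exact pos_of_mul_pos_right this (inv_nonneg.2 hg.le)
  have hd' : (0 : ℝ) < d := by exact_mod_cast hd
  have hsumw : ∑ _x ∈ F, (d : ℝ)⁻¹ = 1 := by
    rw [Finset.sum_const, (mem_faces.1 hF).2, nsmul_eq_mul, mul_inv_cancel₀ hd'.ne']
  set m : Vec d := ∑ x ∈ F, (d : ℝ)⁻¹ • x with hm
  have hmF : m ∈ convexHull ℝ (F : Set (Vec d)) :=
    (convex_convexHull ℝ _).sum_mem (fun _ _ => inv_nonneg.2 hd'.le) hsumw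
      fun x hx => subset_convexHull ℝ _ (Finset.mem_coe.2 hx)
  have hbm : ∀ x ∈ F, bary T.1 x m = (d : ℝ)⁻¹ := by
    intro x hx
    have hxT := mem_adjacent.1 hT hx
    have h1 := F.map_affineCombination (fun i => i) (fun _ => (d : ℝ)⁻¹) hsumw (bary T.1 x)
    rw [Finset.affineCombination_eq_linear_combination _ _ _ hsumw,
      Finset.affineCombination_eq_linear_combination _ _ _ hsumw, ← hm] at h1
    rw [h1, Finset.sum_eq_single x]
    · simp [bary_self hS hxT]
    · intro z hz hzx
      simp [bary_ne hS hxT (mem_adjacent.1 hT hz) (Ne.symm hzx)]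
    · exact fun h => absurd hx h
  have hline : ∀ (w : Vec d →ᵃ[ℝ] ℝ) (t : ℝ),
      w (AffineMap.lineMap m b t) = (1 - t) * w m + t * w b := by
    intro w t
    rw [AffineMap.apply_lineMap, AffineMap.lineMap_apply_ring]
  -- At the centroid m of the face all coordinates belonging to its vertices equal 1/d. They stay
  -- positive for a small move towards b, which therefore leads to a point of both T and T' off the
  -- face.
  have hev : ∀ᶠ t in nhdsWithin (0 : ℝ) (Set.Ioi 0),
      t < 1 ∧ ∀ x ∈ F, 0 ≤ bary T.1 x (AffineMap.lineMap m b t) := by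
    refine Filter.Eventually.and ?_ ?_
    · exact nhdsWithin_le_nhds (Iio_mem_nhds one_pos)
    · rw [Filter.eventually_all_finset]
      intro x hx
      refine nhdsWithin_le_nhds ?_
      have hc : Continuous fun t : ℝ => bary T.1 x (AffineMap.lineMap m b t) := by
        simp_rw [hline]; fun_prop
      have h0 : 0 < bary T.1 x (AffineMap.lineMap m b (0 : ℝ)) := by
        rw [AffineMap.lineMap_apply_zero, hbm x hx]; positivity
      filter_upwards [hc.continuousAt.eventually (lt_mem_nhds h0)] with t ht using ht.le
  obtain ⟨t, ⟨ht1, ht⟩, ht0⟩ := (hev.and self_mem_nhdsWithin).exists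
  have ht0 : 0 < t := ht0
  set q : Vec d := AffineMap.lineMap m b t with hq
  have hqa : bary T.1 a q = t * bary T.1 a b := by
    have : bary T.1 a m = 0 := by
      rw [hFa] at hmF
      exact ((mem_convexHull_erase_iff_bary hS ha).1 hmF).2
    rw [hq, hline, this, mul_zero, zero_add]
  have hqa0 : 0 < bary T.1 a q := by rw [hqa]; positivity
  have hqT : q ∈ convexHull ℝ (T.1 : Set (Vec d)) := by
    rw [mem_convexHull_iff_bary hS]
    intro x hx
    by_cases hxa : x = a
    · rw [hxa]; exact hqa0.le
    · exact ht x (by rw [hFa]; exact Finset.mem_erase.2 ⟨hxa, hx⟩)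
  have hqT' : q ∈ convexHull ℝ (T'.1 : Set (Vec d)) := by
    refine (convex_convexHull ℝ _).lineMap_mem
      (convexHull_mono (Finset.coe_subset.2 (mem_adjacent.1 hT')) hmF)
      (subset_convexHull ℝ _ (Finset.mem_coe.2 hb)) ⟨ht0.le, ht1.le⟩
  -- Conformity: the common point lies in the hull of the common vertices, which all belong to F,
  -- where λ_a = 0.
  have hint := M.cplx.inter_subset_convexHull (mem_elements.1 T.2).1 (mem_elements.1 T'.2).1
    ⟨hqT, hqT'⟩
  have hsub : (T.1 ∩ T'.1 : Set (Vec d)) ⊆ (F : Set (Vec d)) := by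
    rintro x ⟨hx, hx'⟩
    by_cases hxa : x = a
    · exfalso
      have hTT : T.1 ⊆ T'.1 := by
        intro z hz
        by_cases hza : z = a
        · rw [hza, ← hxa]; exact hx'
        · exact mem_adjacent.1 hT' (by rw [hFa]; exact Finset.mem_erase.2 ⟨hza, hz⟩)
      exact hne (Subtype.ext (Finset.eq_of_subset_of_card_le hTT
        (by rw [hS.card_eq, hS'.card_eq])))
    · rw [Finset.mem_coe, hFa]
      exact Finset.mem_erase.2 ⟨hxa, hx⟩
  have hqF := convexHull_mono hsub hint
  rw [hFa] at hqF
  exact hqa0.ne' ((mem_convexHull_erase_iff_bary hS ha).1 hqF).2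

include N in
theorem Normals.card_adjacent_le (hd : 1 ≤ d) {F : Finset (Vec d)} (hF : F ∈ M.faces) :
    (M.adjacent F).card ≤ 2 := by
  have h := Finset.card_le_card_of_injOn (s := M.adjacent F) (t := ({1, -1} : Finset ℝ)) (N.sgn F)
    (fun T _ => by rcases N.sgn_cases F T with h | h <;> simp [h]) (N.sgn_injOn hd hF)
  exact h.trans Finset.card_le_two

theorem mem_interiorFaces {F : Finset (Vec d)} :
    F ∈ M.interiorFaces ↔ F ∈ M.faces ∧ (M.adjacent F).card = 2 := by
  simp [interiorFaces]

theorem mem_boundaryFaces {F : Finset (Vec d)} :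
    F ∈ M.boundaryFaces ↔ F ∈ M.faces ∧ (M.adjacent F).card = 1 := by
  simp [boundaryFaces]

include N in
theorem Normals.interior_or_boundary (hd : 1 ≤ d) {F : Finset (Vec d)} (hF : F ∈ M.faces) :
    F ∈ M.interiorFaces ∨ F ∈ M.boundaryFaces := by
  have h1 := N.card_adjacent_le hd hF
  have h2 := Finset.card_pos.2 (adjacent_nonempty hF)
  rw [mem_interiorFaces, mem_boundaryFaces]
  by_cases h : (M.adjacent F).card = 2
  · exact Or.inl ⟨hF, h⟩
  · exact Or.inr ⟨hF, by omega⟩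

theorem Normals.exists_interior (hd : 1 ≤ d) {F : Finset (Vec d)} (hF : F ∈ M.interiorFaces) :
    ∃ T₁ T₂ : M.elements, T₁ ≠ T₂ ∧ M.adjacent F = {T₁, T₂} ∧ N.sgn F T₁ = 1 ∧ N.sgn F T₂ = -1 := by
  obtain ⟨hF, hc⟩ := mem_interiorFaces.1 hF
  obtain ⟨T₁, T₂, hne, hadj⟩ := Finset.card_eq_two.1 hc
  have h1 : T₁ ∈ M.adjacent F := by simp [hadj]
  have h2 : T₂ ∈ M.adjacent F := by simp [hadj]
  have hinj : N.sgn F T₁ ≠ N.sgn F T₂ := fun h => hne (N.sgn_injOn hd hF h1 h2 h)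
  rcases N.sgn_cases F T₁ with e1 | e1 <;> rcases N.sgn_cases F T₂ with e2 | e2
  · exact absurd (e1.trans e2.symm) hinj
  · exact ⟨T₁, T₂, hne, hadj, e1, e2⟩
  · exact ⟨T₂, T₁, hne.symm, by rw [hadj, Finset.pair_comm], e2, e1⟩
  · exact absurd (e1.trans e2.symm) hinj

theorem Normals.exists_boundary {F : Finset (Vec d)} (hF : F ∈ M.boundaryFaces) :
    ∃ T : M.elements, M.adjacent F = {T} ∧ N.sgn F T = 1 := by
  obtain ⟨T, hT⟩ := Finset.card_eq_one.1 (mem_boundaryFaces.1 hF).2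
  refine ⟨T, hT, ?_⟩
  rw [Normals.sgn, if_pos (N.outward F hF T (by simp [hT]))]

end Normals

end Mesh

/-! ### Jumps and averages as affine functions on a face -/

/-- Evaluation at a point as a linear map on affine functions. -/
def evalLin (x : Vec d) : (Vec d →ᵃ[ℝ] X) →ₗ[ℝ] X where
  toFun w := w x
  map_add' _ _ := rfl
  map_smul' _ _ := rfl

/-- The mean over the vertices of a face as a linear map on affine functions. -/
def vmeanLin (F : Finset (Vec d)) : (Vec d →ᵃ[ℝ] X) →ₗ[ℝ] X :=
  (d : ℝ)⁻¹ • ∑ x ∈ F, evalLin x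

theorem vmeanLin_apply (F : Finset (Vec d)) (w : Vec d →ᵃ[ℝ] X) : vmeanLin F w = vmean F w := by
  simp [vmeanLin, vmean, evalLin]

namespace Mesh

variable {M : Mesh d} (N : M.Normals)

section Linear

variable {Y Z : Type} [AddCommGroup Y] [Module ℝ Y] [AddCommGroup Z] [Module ℝ Z]

theorem Normals.map_jump (L : Y →ₗ[ℝ] Z) (F : Finset (Vec d)) (f : M.elements → Y) :
    L (N.jump F f) = N.jump F (fun T => L (f T)) := by
  simp [Normals.jump, map_sum]

theorem map_avg (L : Y →ₗ[ℝ] Z) (F : Finset (Vec d)) (f : M.elements → Y) :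
    L (M.avg F f) = M.avg F (fun T => L (f T)) := by
  simp [avg, map_sum]

theorem avg_interior {F : Finset (Vec d)} {T₁ T₂ : M.elements} (hne : T₁ ≠ T₂)
    (hadj : M.adjacent F = {T₁, T₂}) (f : M.elements → Y) :
    M.avg F f = (2 : ℝ)⁻¹ • (f T₁ + f T₂) := by
  rw [avg, hadj, Finset.card_pair hne, Finset.sum_pair hne]; norm_num

theorem avg_boundary {F : Finset (Vec d)} {T : M.elements}
    (hadj : M.adjacent F = {T}) (f : M.elements → Y) : M.avg F f = f T := by
  rw [avg, hadj]; simp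

theorem Normals.jump_interior (hd : 1 ≤ d) {F : Finset (Vec d)} (hF : F ∈ M.faces)
    {T₁ T₂ : M.elements} (hne : T₁ ≠ T₂) (hadj : M.adjacent F = {T₁, T₂}) (h1 : N.sgn F T₁ = 1)
    (h2 : N.sgn F T₂ = -1) (f : M.elements → Y) : N.jump F f = f T₁ - f T₂ := by
  rw [N.jump_eq_sum hd hF, hadj, Finset.sum_pair hne, h1, h2, one_smul, neg_smul, one_smul,
    sub_eq_add_neg]

theorem Normals.jump_boundary (hd : 1 ≤ d) {F : Finset (Vec d)} (hF : F ∈ M.faces)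
    {T : M.elements} (hadj : M.adjacent F = {T}) (h1 : N.sgn F T = 1)
    (f : M.elements → Y) : N.jump F f = f T := by
  rw [N.jump_eq_sum hd hF, hadj, Finset.sum_singleton, h1, one_smul]

end Linear

/-- Evaluation is linear, so the jump of the traces is the trace of a single affine function, to
which the face integration formulas apply. -/
theorem Normals.jump_apply (F : Finset (Vec d)) (u : M.DG X) (x : Vec d) :
    N.jump F (fun T => u T x) = (N.jump F u : Vec d →ᵃ[ℝ] X) x :=
  (N.map_jump (evalLin x) F u).symm

theorem avg_apply (F : Finset (Vec d)) (u : M.DG X) (x : Vec d) :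
    M.avg F (fun T => u T x) = (M.avg F u : Vec d →ᵃ[ℝ] X) x :=
  (map_avg (evalLin x) F u).symm

theorem Normals.vmean_jump (F : Finset (Vec d)) (u : M.DG X) :
    vmean F (N.jump F u : Vec d →ᵃ[ℝ] X) = N.jump F (fun T => vmean F (u T)) := by
  simp only [← vmeanLin_apply, N.map_jump]

theorem vmean_avg (F : Finset (Vec d)) (u : M.DG X) :
    vmean F (M.avg F u : Vec d →ᵃ[ℝ] X) = M.avg F (fun T => vmean F (u T)) := by
  simp only [← vmeanLin_apply, map_avg]

section Face

variable (hd : 1 ≤ d) {F : Finset (Vec d)} (hF : F ∈ M.faces)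
include hd hF

theorem integrable_face {Y : Type*} [NormedAddCommGroup Y] {f : Vec d → Y} (hf : Continuous f) :
    Integrable f (surf F) := by
  obtain ⟨T, a, ha, rfl⟩ := exists_face_eq_erase hF
  exact integrable_surf_of_continuous (isSimplex T) hd ha hf

theorem integral_face_affine [CompleteSpace X] (w : Vec d →ᵃ[ℝ] X) :
    ∫ x, w x ∂(surf F) = area F • vmean F w := by
  obtain ⟨T, a, ha, rfl⟩ := exists_face_eq_erase hF
  exact integral_surf_affine (isSimplex T) hd ha w

theorem P0_face_affine [CompleteSpace X] (w : Vec d →ᵃ[ℝ] X) : P0 F w = vmean F w := by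
  obtain ⟨T, a, ha, rfl⟩ := exists_face_eq_erase hF
  exact P0_affine (isSimplex T) hd ha w

theorem Normals.P0_jump [CompleteSpace X] (u : M.DG X) :
    P0 F (fun x => N.jump F (fun T => u T x)) = N.jump F (fun T => vmean F (u T)) := by
  simp only [N.jump_apply]
  rw [← N.vmean_jump, ← P0_face_affine hd hF]

theorem P0_avg [CompleteSpace X] (u : M.DG X) :
    P0 F (fun x => M.avg F (fun T => u T x)) = M.avg F (fun T => vmean F (u T)) := by
  simp only [avg_apply]
  rw [← vmean_avg, ← P0_face_affine hd hF]

theorem integral_inner_affine (c : Vec d) (w : Vec d →ᵃ[ℝ] Vec d) :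
    ∫ x, inner ℝ c (w x) ∂(surf F) = area F * inner ℝ c (vmean F w) := by
  rw [integral_inner (integrable_face hd hF w.continuous_of_finiteDimensional),
    integral_face_affine hd hF, inner_smul_right]

theorem Normals.integral_inner_jump (c : Vec d) (u : M.DG (Vec d)) :
    ∫ x, inner ℝ c (N.jump F (fun T => u T x)) ∂(surf F) =
      area F * inner ℝ c (N.jump F (fun T => vmean F (u T))) := by
  simp only [N.jump_apply]
  rw [integral_inner_affine hd hF, N.vmean_jump]

end Face

theorem mem_iD {D : Finset (Finset (Vec d))} {F : Finset (Vec d)} :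
    F ∈ M.interiorOrDirichlet D ↔ F ∈ M.interiorFaces ∨ F ∈ D := by
  simp [interiorOrDirichlet]

theorem mem_iN {D : Finset (Finset (Vec d))} {F : Finset (Vec d)} :
    F ∈ M.interiorOrNeumann D ↔ F ∈ M.interiorFaces ∨ (F ∈ M.boundaryFaces ∧ F ∉ D) := by
  simp [interiorOrNeumann]

theorem interiorOrDirichlet_subset {D : Finset (Finset (Vec d))} (hD : D ⊆ M.boundaryFaces) :
    M.interiorOrDirichlet D ⊆ M.faces := by
  intro F hF
  rcases mem_iD.1 hF with h | h
  · exact (mem_interiorFaces.1 h).1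
  · exact (mem_boundaryFaces.1 (hD h)).1

theorem interiorOrNeumann_subset (D : Finset (Finset (Vec d))) :
    M.interiorOrNeumann D ⊆ M.faces := by
  intro F hF
  rcases mem_iN.1 hF with h | h
  · exact (mem_interiorFaces.1 h).1
  · exact (mem_boundaryFaces.1 h.1).1

end Mesh

/-! ### Algebra of the elasticity tensor -/

section Tensor

theorem frob_comm (A B : Matrix (Fin d) (Fin d) ℝ) : frob A B = frob B A := by
  simp only [frob, mul_comm]

theorem frob_add_left (A B C : Matrix (Fin d) (Fin d) ℝ) :
    frob (A + B) C = frob A C + frob B C := by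
  simp only [frob, Matrix.add_apply, add_mul, Finset.sum_add_distrib]

theorem frob_smul_left (c : ℝ) (A B : Matrix (Fin d) (Fin d) ℝ) :
    frob (c • A) B = c * frob A B := by
  simp only [frob, Matrix.smul_apply, smul_eq_mul, mul_assoc, Finset.mul_sum]

theorem frob_one_left (A : Matrix (Fin d) (Fin d) ℝ) : frob 1 A = A.trace := by
  simp [frob, Matrix.one_apply, Matrix.trace]

theorem frob_self_nonneg (A : Matrix (Fin d) (Fin d) ℝ) : 0 ≤ frob A A :=
  Finset.sum_nonneg fun _ _ => Finset.sum_nonneg fun _ _ => mul_self_nonneg _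

theorem frob_transpose (A B : Matrix (Fin d) (Fin d) ℝ) :
    frob A.transpose B = frob A B.transpose := by
  simp only [frob, Matrix.transpose_apply]
  exact Finset.sum_comm

theorem frob_elast (lam mu : ℝ) (A B : Matrix (Fin d) (Fin d) ℝ) :
    frob (elast lam mu A) B = 2 * mu * frob A B + lam * A.trace * B.trace := by
  rw [elast, frob_add_left, frob_smul_left, frob_smul_left, frob_one_left]

theorem frob_elast_comm (lam mu : ℝ) (A B : Matrix (Fin d) (Fin d) ℝ) :
    frob (elast lam mu A) B = frob (elast lam mu B) A := by
  rw [frob_elast, frob_elast, frob_comm A B]; ring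

theorem eps_transpose (u : Vec d →ᵃ[ℝ] Vec d) : (eps u).transpose = eps u := by
  simp [eps, add_comm]

theorem elast_transpose (lam mu : ℝ) (A : Matrix (Fin d) (Fin d) ℝ) :
    (elast lam mu A).transpose = elast lam mu A.transpose := by
  simp [elast]

theorem frob_eps_of_symm {S : Matrix (Fin d) (Fin d) ℝ} (hS : S.transpose = S)
    (u : Vec d →ᵃ[ℝ] Vec d) : frob S (eps u) = frob S (grad u) := by
  rw [frob_comm, eps, frob_smul_left, frob_add_left, frob_transpose, hS, frob_comm (grad u)]
  ring

theorem trace_sq_le (A : Matrix (Fin d) (Fin d) ℝ) : A.trace ^ 2 ≤ d * frob A A := by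
  have h := sq_sum_le_card_mul_sum_sq (s := (Finset.univ : Finset (Fin d))) (f := fun i => A i i)
  rw [Finset.card_univ, Fintype.card_fin] at h
  refine h.trans (mul_le_mul_of_nonneg_left ?_ (Nat.cast_nonneg d))
  refine Finset.sum_le_sum fun i _ => ?_
  rw [sq]
  exact Finset.single_le_sum (f := fun j => A i j * A i j) (fun j _ => mul_self_nonneg _)
    (Finset.mem_univ i)

/-- The weight β₀ = dλ + 2μ is the eigenvalue of 𝒞 on multiples of the identity; on trace-free
matrices it is 2μ. The gap between the two sides is 2μλ (d |A|² - (tr A)²). -/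
theorem frob_elast_self_le {lam mu : ℝ} (hl : 0 ≤ lam) (hm : 0 ≤ mu)
    (A : Matrix (Fin d) (Fin d) ℝ) :
    frob (elast lam mu A) (elast lam mu A) ≤
      (d * lam + 2 * mu) * frob (elast lam mu A) A := by
  have htr : (elast lam mu A).trace = 2 * mu * A.trace + lam * A.trace * d := by
    simp [elast, Matrix.trace_add, Matrix.trace_smul]
  have h1 : frob (elast lam mu A) (elast lam mu A) =
      2 * mu * (2 * mu * frob A A + lam * A.trace * A.trace) +
        lam * A.trace * (2 * mu * A.trace + lam * A.trace * d) := by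
    rw [frob_elast, htr, frob_comm A, frob_elast]
  rw [h1, frob_elast]
  have h2 := mul_le_mul_of_nonneg_left (trace_sq_le A) (mul_nonneg hl hm)
  nlinarith [h2]

theorem frob_elast_nonneg {lam mu : ℝ} (hl : 0 ≤ lam) (hm : 0 ≤ mu)
    (A : Matrix (Fin d) (Fin d) ℝ) : 0 ≤ frob (elast lam mu A) A := by
  rw [frob_elast, mul_assoc lam]
  have := frob_self_nonneg A
  have := mul_self_nonneg A.trace
  positivity

theorem norm_toEuclideanLin_sq_le (A : Matrix (Fin d) (Fin d) ℝ) (v : Vec d) :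
    ‖Matrix.toEuclideanLin A v‖ ^ 2 ≤ frob A A * ‖v‖ ^ 2 := by
  rw [EuclideanSpace.real_norm_sq_eq, EuclideanSpace.real_norm_sq_eq, frob, Finset.sum_mul]
  refine Finset.sum_le_sum fun i _ => ?_
  have h := Finset.sum_mul_sq_le_sq_mul_sq Finset.univ (fun j => A i j) (fun j => v j)
  simpa [Matrix.toLpLin_apply, Matrix.mulVec, dotProduct, sq] using h

end Tensor

/-! ### Face identities and the orthogonality for 𝒜₀ -/

namespace Mesh

variable {M : Mesh d} (N : M.Normals)

theorem Normals.jump_sq_le (hd : 1 ≤ d) {F : Finset (Vec d)} (hF : F ∈ M.faces)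
    (f : M.elements → ℝ) : N.jump F f ^ 2 ≤ 2 * ∑ T ∈ M.adjacent F, f T ^ 2 := by
  rcases N.interior_or_boundary hd hF with h | h
  · obtain ⟨T₁, T₂, hne, hadj, h1, h2⟩ := N.exists_interior hd h
    rw [N.jump_interior hd hF hne hadj h1 h2, hadj, Finset.sum_pair hne]
    nlinarith [sq_nonneg (f T₁ + f T₂)]
  · obtain ⟨T, hadj, h1⟩ := N.exists_boundary h
    rw [N.jump_boundary hd hF hadj h1, hadj, Finset.sum_singleton]
    nlinarith [sq_nonneg (f T)]

include N in
theorem Normals.norm_avg_sq_le (hd : 1 ≤ d) {F : Finset (Vec d)} (hF : F ∈ M.faces)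
    (f : M.elements → Vec d) : ‖M.avg F f‖ ^ 2 ≤ ∑ T ∈ M.adjacent F, ‖f T‖ ^ 2 := by
  rcases N.interior_or_boundary hd hF with h | h
  · obtain ⟨T₁, T₂, hne, hadj, h1, h2⟩ := N.exists_interior hd h
    rw [avg_interior hne hadj, hadj, Finset.sum_pair hne, norm_smul]
    have h3 := norm_add_le (f T₁) (f T₂)
    have h4 : ‖(2 : ℝ)⁻¹‖ = 2⁻¹ := by norm_num
    rw [h4]
    nlinarith [sq_nonneg (‖f T₁‖ - ‖f T₂‖), norm_nonneg (f T₁ + f T₂), norm_nonneg (f T₁),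
      norm_nonneg (f T₂), sq_nonneg (‖f T₁‖ + ‖f T₂‖)]
  · obtain ⟨T, hadj, h1⟩ := N.exists_boundary h
    rw [avg_boundary hadj, hadj, Finset.sum_singleton]

/-- The product rule for jumps on a face on which the second factor has the average `0`, unless the
face belongs to the boundary. -/
theorem Normals.sum_sgn_inner (hd : 1 ≤ d) {F : Finset (Vec d)} (hF : F ∈ M.faces)
    (p q : M.elements → Vec d) (hq : F ∈ M.interiorFaces → M.avg F q = 0) :
    ∑ T ∈ M.adjacent F, N.sgn F T * inner ℝ (p T) (q T) = inner ℝ (M.avg F p) (N.jump F q) := by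
  rcases N.interior_or_boundary hd hF with h | h
  · obtain ⟨T₁, T₂, hne, hadj, h1, h2⟩ := N.exists_interior hd h
    have h0 := hq h
    rw [avg_interior hne hadj] at h0
    -- Opposite traces meet opposite normals, so both signed terms carry the factor q T₁, and the
    -- jump is twice that.
    have h3 : q T₂ = -q T₁ := by
      have := (smul_eq_zero.1 h0).resolve_left (by norm_num)
      exact (neg_eq_of_add_eq_zero_right this).symm
    rw [hadj, Finset.sum_pair hne, N.jump_interior hd hF hne hadj h1 h2, avg_interior hne hadj,
      h1, h2, h3, inner_smul_left, inner_neg_right, sub_neg_eq_add, inner_add_left,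
      inner_add_right, inner_add_right]
    simp
    ring
  · obtain ⟨T, hadj, h1⟩ := N.exists_boundary h
    rw [hadj, Finset.sum_singleton, N.jump_boundary hd hF hadj h1, avg_boundary hadj, h1, one_mul]

section Forms

variable (hd : 1 ≤ d) {D : Finset (Finset (Vec d))} (hD : D ⊆ M.boundaryFaces)
include hd hD

/-- Stresses are constant and jumps affine, so every integral reduces to a volume, or an area times
a vertex mean. -/
theorem formA0_eq (lam mu α₀ : ℝ) (u w : M.DG (Vec d)) :
    formA0 N D lam mu α₀ u w =
      (∑ T : M.elements, vol T.1 * frob (elast lam mu (eps (u T))) (eps (w T)))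
      - (∑ F ∈ M.interiorOrDirichlet D, area F *
          inner ℝ (avgStress N lam mu F u) (N.jump F (fun T => vmean F (w T))))
      - (∑ F ∈ M.interiorOrDirichlet D, area F *
          inner ℝ (avgStress N lam mu F w) (N.jump F (fun T => vmean F (u T))))
      + α₀ * (d * lam + 2 * mu) * ∑ F ∈ M.interiorOrDirichlet D, area F * ((faceDiam F)⁻¹ *
          inner ℝ (N.jump F (fun T => vmean F (u T))) (N.jump F (fun T => vmean F (w T)))) := by
  have hsub := interiorOrDirichlet_subset hD
  rw [formA0, penalty0]
  congr 1
  · congr 1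
    · congr 1
      · refine Finset.sum_congr rfl fun T _ => ?_
        rw [setIntegral_const]; rfl
      · refine Finset.sum_congr rfl fun F hF => ?_
        exact N.integral_inner_jump hd (hsub hF) _ _
    · refine Finset.sum_congr rfl fun F hF => ?_
      simp only [real_inner_comm (avgStress N lam mu F w)]
      exact N.integral_inner_jump hd (hsub hF) _ _
  · congr 1
    refine Finset.sum_congr rfl fun F hF => ?_
    rw [N.P0_jump hd (hsub hF)]
    simp only [real_inner_comm (N.jump F (fun T => vmean F (w T))), real_inner_smul_right]
    rw [integral_const_mul, N.integral_inner_jump hd (hsub hF)]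
    ring

theorem IsCR.jump_vmean {v : M.DG (Vec d)} (hv : IsCR N D v) {F : Finset (Vec d)}
    (hF : F ∈ M.interiorOrDirichlet D) : N.jump F (fun T => vmean F (v T)) = 0 := by
  rw [← N.P0_jump hd (interiorOrDirichlet_subset hD hF)]
  exact hv F hF

omit hD in
theorem IsZ.avg_vmean [CompleteSpace X] {z : M.DG X} (hz : IsZ D z) {F : Finset (Vec d)}
    (hF : F ∈ M.interiorOrNeumann D) : M.avg F (fun T => vmean F (z T)) = 0 := by
  rw [← P0_avg hd (interiorOrNeumann_subset D hF)]
  exact hz F hF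

/-- The spaces `𝒵` and `V^CR` are orthogonal with respect to `𝒜₀`. -/
theorem formA0_eq_zero (lam mu α₀ : ℝ) {z v : M.DG (Vec d)} (hz : IsZ D z) (hv : IsCR N D v) :
    formA0 N D lam mu α₀ z v = 0 := by
  have hsub := interiorOrDirichlet_subset hD
  have h1 : ∑ T : M.elements, vol T.1 * frob (elast lam mu (eps (z T))) (eps (v T)) =
      ∑ F ∈ M.interiorOrDirichlet D, area F *
          inner ℝ (avgStress N lam mu F v) (N.jump F (fun T => vmean F (z T))) := by
    set G : M.elements → Finset (Vec d) → ℝ := fun T F => area F * (N.sgn F T *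
      inner ℝ (Matrix.toEuclideanLin (elast lam mu (eps (v T))) (N.normal F)) (vmean F (z T)))
      with hG
    have h2 : ∀ T : M.elements, vol T.1 * frob (elast lam mu (eps (z T))) (eps (v T)) =
        ∑ a ∈ T.1, G T (T.1.erase a) := by
      intro T
      rw [frob_elast_comm, frob_eps_of_symm (by rw [elast_transpose, eps_transpose]),
        vol_mul_frob_grad (isSimplex T) hd]
      refine Finset.sum_congr rfl fun a ha => ?_
      rw [hG, ← N.sgn_smul_normal hd ha, map_smul, real_inner_smul_left]
    rw [Finset.sum_congr rfl fun T _ => h2 T, sum_elements_erase hd]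
    have h3 : ∀ F ∈ M.faces, ∑ T ∈ M.adjacent F, G T F =
        area F * inner ℝ (avgStress N lam mu F v) (N.jump F (fun T => vmean F (z T))) := by
      intro F hF
      rw [hG, ← Finset.mul_sum, N.sum_sgn_inner hd hF, avgStress]
      exact fun h => hz.avg_vmean hd (mem_iN.2 (Or.inl h))
    rw [Finset.sum_congr rfl h3]
    -- The faces left over are Neumann faces, where the one-sided mean of z is zero.
    refine (Finset.sum_subset hsub fun F hF hFn => ?_).symm
    have hFD := fun h => hFn (mem_iD.2 h)
    have hFi : F ∉ M.interiorFaces := fun h => hFD (Or.inl h)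
    have hFb := (N.interior_or_boundary hd hF).resolve_left hFi
    have h0 := hz.avg_vmean hd (mem_iN.2 (Or.inr ⟨hFb, fun h => hFD (Or.inr h)⟩))
    obtain ⟨T, hadj, hs⟩ := N.exists_boundary hFb
    rw [avg_boundary hadj] at h0
    rw [N.jump_boundary hd hF hadj hs, h0, inner_zero_right, mul_zero]
  rw [formA0_eq N hd hD, h1]
  have h4 : ∑ F ∈ M.interiorOrDirichlet D, area F *
      inner ℝ (avgStress N lam mu F z) (N.jump F (fun T => vmean F (v T))) = 0 :=
    Finset.sum_eq_zero fun F hF => by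
      rw [hv.jump_vmean N hd hD hF, inner_zero_right, mul_zero]
  have h5 : ∑ F ∈ M.interiorOrDirichlet D, area F * ((faceDiam F)⁻¹ *
          inner ℝ (N.jump F (fun T => vmean F (z T))) (N.jump F (fun T => vmean F (v T)))) = 0 :=
    Finset.sum_eq_zero fun F hF => by
      rw [hv.jump_vmean N hd hD hF, inner_zero_right, mul_zero, mul_zero]
  rw [h4, h5]
  ring

end Forms

end Mesh

namespace Mesh

variable {M : Mesh d} (N : M.Normals)

/-! ### Nonnegativity of 𝒜₀ -/

section Coercivity

variable (hd : 2 ≤ d) {σ : ℝ} (hσ : 0 < σ) (hM : M.ShapeRegular σ)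
  {D : Finset (Finset (Vec d))} (hD : D ⊆ M.boundaryFaces)
include hd hM

theorem ShapeRegular.faceDiam_mul_area_le (T : M.elements) {a : Vec d} (ha : a ∈ T.1) :
    faceDiam (T.1.erase a) * area (T.1.erase a) ≤ σ * d * vol T.1 := by
  obtain ⟨c, r, hr, hball, hdiam⟩ := hM T.1 T.2
  exact ElasticityDG.faceDiam_mul_area_le (isSimplex T) hd hr hball hdiam ha

theorem ShapeRegular.inv_faceDiam_mul_area_le (T : M.elements) {a b : Vec d} (ha : a ∈ T.1)
    (hb : b ∈ T.1) : (faceDiam (T.1.erase a))⁻¹ * area (T.1.erase a) ≤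
      σ ^ 2 * ((faceDiam (T.1.erase b))⁻¹ * area (T.1.erase b)) := by
  obtain ⟨c, r, hr, hball, hdiam⟩ := hM T.1 T.2
  exact ElasticityDG.inv_faceDiam_mul_area_le (isSimplex T) hd hr hball hdiam ha hb

theorem ShapeRegular.faceDiam_pos {F : Finset (Vec d)} (hF : F ∈ M.faces) : 0 < faceDiam F := by
  obtain ⟨T, a, ha, rfl⟩ := exists_face_eq_erase hF
  obtain ⟨c, r, hr, hball, hdiam⟩ := hM T.1 T.2
  have := le_faceDiam (isSimplex T) hd ha hr hball
  linarith

include hσ hD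

/-- The form `𝒜₀` is positive semidefinite if the penalty parameter is large enough. -/
theorem formA0_self_nonneg {lam mu α₀ : ℝ} (hl : 0 ≤ lam) (hm : 0 < mu)
    (hα : (d + 1) * d * σ ≤ α₀) (u : M.DG (Vec d)) : 0 ≤ formA0 N D lam mu α₀ u u := by
  have hd1 : 1 ≤ d := by omega
  have hsub := interiorOrDirichlet_subset hD
  have hdp : (0 : ℝ) < d := by exact_mod_cast hd1
  rw [formA0_eq N hd1 hD]
  set S : M.elements → Matrix (Fin d) (Fin d) ℝ := fun T => elast lam mu (eps (u T)) with hS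
  set q : M.elements → ℝ := fun T => frob (S T) (eps (u T)) with hq
  -- Chosen so that the stress terms are absorbed exactly: an element has d + 1 faces, and each
  -- contributes h_E |E| ≤ σ d |T|.
  set κ : ℝ := (d + 1) * d * σ with hκ
  set β : ℝ := d * lam + 2 * mu with hβ
  set J : Finset (Vec d) → Vec d := fun F => N.jump F (fun T => vmean F (u T)) with hJ
  set P : Finset (Vec d) → Vec d := fun F => avgStress N lam mu F u with hP
  have hκp : 0 < κ := by positivity
  have hβp : 0 < β := by positivity
  have hq0 : ∀ T, 0 ≤ q T := fun T => frob_elast_nonneg hl hm.le _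
  have hPle : ∀ F ∈ M.faces, ‖P F‖ ^ 2 ≤ β * ∑ T ∈ M.adjacent F, q T := by
    intro F hF
    refine (N.norm_avg_sq_le hd1 hF _).trans ?_
    rw [Finset.mul_sum]
    refine Finset.sum_le_sum fun T _ => ?_
    refine (norm_toEuclideanLin_sq_le _ _).trans ?_
    rw [N.norm_eq_one F hF, one_pow, mul_one]
    exact frob_elast_self_le hl hm.le _
  have hface : ∀ F ∈ M.interiorOrDirichlet D, 2 * (area F * inner ℝ (P F) (J F)) ≤
      ∑ T ∈ M.adjacent F, κ⁻¹ * (faceDiam F * area F) * q T +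
        α₀ * β * (area F * ((faceDiam F)⁻¹ * inner ℝ (J F) (J F))) := by
    intro F hF
    have hh := hM.faceDiam_pos hd (hsub hF)
    have hA := area_nonneg F
    have h1 := hPle F (hsub hF)
    have h2 := real_inner_le_norm (P F) (J F)
    set h := faceDiam F
    -- Young's inequality. The weights put κ⁻¹ on the elastic energy and κ ≤ α₀ on the penalty.
    have h3 : 2 * (‖P F‖ * ‖J F‖) ≤ κ⁻¹ * h * β⁻¹ * ‖P F‖ ^ 2 + κ * β * h⁻¹ * ‖J F‖ ^ 2 := by
      have h4 : κ⁻¹ * h * β⁻¹ * ‖P F‖ ^ 2 + κ * β * h⁻¹ * ‖J F‖ ^ 2 - 2 * (‖P F‖ * ‖J F‖) =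
          κ⁻¹ * h * β⁻¹ * (‖P F‖ - κ * β * h⁻¹ * ‖J F‖) ^ 2 := by
        field_simp
        ring
      have h5 : 0 ≤ κ⁻¹ * h * β⁻¹ * (‖P F‖ - κ * β * h⁻¹ * ‖J F‖) ^ 2 := by positivity
      linarith
    have h6 : κ⁻¹ * h * β⁻¹ * ‖P F‖ ^ 2 ≤ κ⁻¹ * h * ∑ T ∈ M.adjacent F, q T := by
      calc κ⁻¹ * h * β⁻¹ * ‖P F‖ ^ 2 ≤ κ⁻¹ * h * β⁻¹ * (β * ∑ T ∈ M.adjacent F, q T) :=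
            mul_le_mul_of_nonneg_left h1 (by positivity)
        _ = κ⁻¹ * h * ∑ T ∈ M.adjacent F, q T := by field_simp
    have h7 : κ * β * h⁻¹ * ‖J F‖ ^ 2 ≤ α₀ * β * h⁻¹ * ‖J F‖ ^ 2 := by gcongr
    rw [real_inner_self_eq_norm_sq, ← Finset.mul_sum]
    calc 2 * (area F * inner ℝ (P F) (J F)) = area F * (2 * inner ℝ (P F) (J F)) := by ring
      _ ≤ area F * (κ⁻¹ * h * ∑ T ∈ M.adjacent F, q T + α₀ * β * h⁻¹ * ‖J F‖ ^ 2) :=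
          mul_le_mul_of_nonneg_left (by linarith) hA
      _ = _ := by ring
  have hvol : ∑ F ∈ M.interiorOrDirichlet D,
      ∑ T ∈ M.adjacent F, κ⁻¹ * (faceDiam F * area F) * q T ≤ ∑ T : M.elements, vol T.1 * q T := by
    have hnn : ∀ F : Finset (Vec d), ∀ T : M.elements,
        0 ≤ κ⁻¹ * (faceDiam F * area F) * q T := fun F T =>
      mul_nonneg (mul_nonneg (inv_nonneg.2 hκp.le) (mul_nonneg Metric.diam_nonneg (area_nonneg F)))
        (hq0 T)
    refine (Finset.sum_le_sum_of_subset_of_nonneg hsub fun F _ _ =>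
      Finset.sum_nonneg fun T _ => hnn F T).trans ?_
    rw [← sum_elements_erase hd1 (fun T F => κ⁻¹ * (faceDiam F * area F) * q T)]
    refine Finset.sum_le_sum fun T _ => ?_
    have h1 : ∀ a ∈ T.1, κ⁻¹ * (faceDiam (T.1.erase a) * area (T.1.erase a)) * q T ≤
        κ⁻¹ * (σ * d * vol T.1) * q T := fun a ha =>
      mul_le_mul_of_nonneg_right (mul_le_mul_of_nonneg_left
        (hM.faceDiam_mul_area_le hd T ha) (inv_nonneg.2 hκp.le)) (hq0 T)
    refine (Finset.sum_le_sum h1).trans (le_of_eq ?_)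
    rw [Finset.sum_const, (isSimplex T).card_eq, nsmul_eq_mul, hκ]
    push_cast
    field_simp
  have hsum := Finset.sum_le_sum hface
  rw [Finset.sum_add_distrib, ← Finset.mul_sum, ← Finset.mul_sum] at hsum
  linarith

end Coercivity

/-! ### The jump estimate on shape-regular meshes -/

section JumpEstimate

/-- On a face, the `L²` norm of an affine function is controlled by the values at the vertices. -/
theorem integral_sq_le (hd : 1 ≤ d) {F : Finset (Vec d)} (hF : F ∈ M.faces)
    (w : Vec d →ᵃ[ℝ] ℝ) : ∫ x, w x ^ 2 ∂(surf F) ≤ area F * ∑ y ∈ F, w y ^ 2 := by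
  have hcont := w.continuous_of_finiteDimensional
  have h1 : ∫ x, w x ^ 2 ∂(surf F) ≤ ∫ _x, ∑ y ∈ F, w y ^ 2 ∂(surf F) := by
    refine integral_mono_ae (integrable_face hd hF (by fun_prop))
      (integrable_face hd hF continuous_const) ?_
    filter_upwards [ae_surf_mem F] with x hx
    -- The square of an affine function is convex, so its maximum over the face is attained at a
    -- vertex.
    have hc : ConvexOn ℝ Set.univ fun x => w x ^ 2 :=
      (even_two.convexOn_pow (𝕜 := ℝ)).comp_affineMap w
    obtain ⟨y, hy, hxy⟩ := (hc.subset (Set.subset_univ _) (convex_convexHull ℝ _)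
      ).exists_ge_of_mem_convexHull (subset_convexHull ℝ _) hx
    exact hxy.trans (Finset.single_le_sum (f := fun y => w y ^ 2) (fun y _ => sq_nonneg _) hy)
  refine h1.trans (le_of_eq ?_)
  rw [integral_const, smul_eq_mul]
  rfl

theorem integral_sub_vmean_sq (hd : 1 ≤ d) {F : Finset (Vec d)} (hF : F ∈ M.faces)
    (w : Vec d →ᵃ[ℝ] ℝ) : ∫ x, (w x - vmean F w) ^ 2 ∂(surf F) =
      ∫ x, w x ^ 2 ∂(surf F) - area F * vmean F w ^ 2 := by
  have hcont := w.continuous_of_finiteDimensional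
  set m := vmean F w with hm
  have h1 : ∀ x, (w x - m) ^ 2 = w x ^ 2 - (2 * m) * w x + m ^ 2 := fun x => by ring
  simp_rw [h1]
  rw [integral_add, integral_sub, integral_const_mul, integral_face_affine hd hF, integral_const,
    smul_eq_mul, smul_eq_mul, ← hm]
  · change _ - _ + area F * m ^ 2 = _
    ring
  all_goals exact integrable_face hd hF (by fun_prop)

/-- The squared values of an affine function at the vertices of a simplex are controlled by its
means over the faces. -/
theorem sq_le_sum_vmean {T : Finset (Vec d)} (hT : IsSimplex T) (hd : 1 ≤ d)
    (w : Vec d →ᵃ[ℝ] ℝ) {y : Vec d} (hy : y ∈ T) :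
    w y ^ 2 ≤ (d + 1) * (d : ℝ) ^ 2 * ∑ a ∈ T, vmean (T.erase a) w ^ 2 := by
  have hd' : (1 : ℝ) ≤ d := by exact_mod_cast hd
  rw [affine_eq_sum_vmean hT hd w hy]
  simp only [smul_eq_mul]
  refine (Finset.sum_mul_sq_le_sq_mul_sq T _ _).trans
    (mul_le_mul_of_nonneg_right ?_ (Finset.sum_nonneg fun _ _ => sq_nonneg _))
  -- The coefficients are 1 - d once and 1 otherwise, all at most d in modulus. There are d + 1 of
  -- them, hence the constant.
  have h : ∀ a ∈ T, (if a = y then 1 - (d : ℝ) else 1) ^ 2 ≤ (d : ℝ) ^ 2 := by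
    intro a _
    split_ifs <;> nlinarith
  refine (Finset.sum_le_sum h).trans (le_of_eq ?_)
  rw [Finset.sum_const, hT.card_eq, nsmul_eq_mul]
  push_cast
  ring

variable (hd : 2 ≤ d) {D : Finset (Finset (Vec d))} (hD : D ⊆ M.boundaryFaces)
include hd

/-- The face means of a function in `𝒵` are controlled by the means of its jumps. -/
theorem IsZ.vmean_sq_le {z : M.DG ℝ} (hz : IsZ D z) {F : Finset (Vec d)} (hF : F ∈ M.faces)
    {T : M.elements} (hT : T ∈ M.adjacent F) :
    vmean F (z T) ^ 2 ≤
      if F ∈ M.interiorOrDirichlet D then N.jump F (fun T => vmean F (z T)) ^ 2 else 0 := by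
  have hd1 : 1 ≤ d := by omega
  rcases N.interior_or_boundary hd1 hF with h | h
  · rw [if_pos (mem_iD.2 (Or.inl h))]
    have h0 := hz.avg_vmean hd1 (mem_iN.2 (Or.inl h))
    obtain ⟨T₁, T₂, hne, hadj, h1, h2⟩ := N.exists_interior hd1 h
    rw [avg_interior hne hadj] at h0
    rw [N.jump_interior hd1 hF hne hadj h1 h2]
    have h3 := (smul_eq_zero.1 h0).resolve_left (by norm_num)
    have h4 : vmean F (z T₂) = -vmean F (z T₁) := by linarith
    rw [hadj, Finset.mem_insert, Finset.mem_singleton] at hT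
    rcases hT with rfl | rfl
    · rw [h4]; nlinarith [sq_nonneg (vmean F (z T))]
    · have h5 : vmean F (z T₁) = -vmean F (z T) := by linarith
      rw [h5]; nlinarith [sq_nonneg (vmean F (z T))]
  · obtain ⟨T', hadj, h1⟩ := N.exists_boundary h
    rw [hadj, Finset.mem_singleton] at hT
    subst hT
    split_ifs with hFD
    · rw [N.jump_boundary hd1 hF hadj h1]
    · have h0 := hz.avg_vmean hd1 (mem_iN.2 (Or.inr ⟨h, fun hh => hFD (mem_iD.2 (Or.inr hh))⟩))
      rw [avg_boundary hadj] at h0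
      rw [h0]; norm_num

include hD

/-- The jumps of a function in `𝒵` are controlled by their means. -/
theorem IsZ.sum_integral_jump_sq_le {σ : ℝ} (hM : M.ShapeRegular σ) {z : M.DG ℝ} (hz : IsZ D z) :
    ∑ F ∈ M.interiorOrDirichlet D, (faceDiam F)⁻¹ *
      ∫ x, (N.jump F z : Vec d →ᵃ[ℝ] ℝ) x ^ 2 ∂(surf F) ≤
    (4 * (d + 1) ^ 2 * (d : ℝ) ^ 3 * σ ^ 2) *
      ∑ F ∈ M.interiorOrDirichlet D, (faceDiam F)⁻¹ *
        (area F * N.jump F (fun T => vmean F (z T)) ^ 2) := by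
  have hd1 : 1 ≤ d := by omega
  have hsub := interiorOrDirichlet_subset hD
  have hinv : ∀ F : Finset (Vec d), 0 ≤ (faceDiam F)⁻¹ := fun F => inv_nonneg.2 Metric.diam_nonneg
  -- Extended by 0 to the Neumann faces, where the means of z vanish, so that sums over all faces of
  -- an element can be used.
  set J : Finset (Vec d) → ℝ := fun F =>
    if F ∈ M.interiorOrDirichlet D then N.jump F (fun T => vmean F (z T)) ^ 2 else 0 with hJ
  have hJ0 : ∀ F, 0 ≤ J F := fun F => by
    simp only [hJ]; split_ifs; exacts [sq_nonneg _, le_rfl]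
  set W : Finset (Vec d) → ℝ := fun F => (faceDiam F)⁻¹ * area F * J F with hW
  have hW0 : ∀ F, 0 ≤ W F := fun F =>
    mul_nonneg (mul_nonneg (hinv F) (area_nonneg F)) (hJ0 F)
  -- The factor 2 comes from splitting the jump into traces, (d + 1) d² from bounding vertex values
  -- by face means, d from the number of vertices of a face, and σ² from moving the weight |E|/h_E
  -- to another face of the element.
  set C : ℝ := 2 * (d + 1) * (d : ℝ) ^ 3 * σ ^ 2 with hC
  set V : M.elements → ℝ := fun T => ∑ a ∈ T.1, W (T.1.erase a) with hV
  have hV0 : ∀ T, 0 ≤ V T := fun T => Finset.sum_nonneg fun a _ => hW0 _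
  have hface : ∀ F ∈ M.faces, (faceDiam F)⁻¹ * ∫ x, (N.jump F z : Vec d →ᵃ[ℝ] ℝ) x ^ 2 ∂(surf F) ≤
      ∑ T ∈ M.adjacent F, C * V T := by
    intro F hF
    have hval : ∀ y ∈ F, (N.jump F z : Vec d →ᵃ[ℝ] ℝ) y ^ 2 ≤ ∑ T ∈ M.adjacent F,
        (2 * ((d + 1) * (d : ℝ) ^ 2)) * ∑ a ∈ T.1, J (T.1.erase a) := by
      intro y hy
      rw [← N.jump_apply]
      refine (N.jump_sq_le hd1 hF _).trans ?_
      rw [Finset.mul_sum]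
      refine Finset.sum_le_sum fun T hT => ?_
      rw [mul_assoc]
      refine mul_le_mul_of_nonneg_left ?_ zero_le_two
      refine (sq_le_sum_vmean (isSimplex T) hd1 (z T) (mem_adjacent.1 hT hy)).trans
        (mul_le_mul_of_nonneg_left ?_ (by positivity))
      refine Finset.sum_le_sum fun a ha => ?_
      exact hz.vmean_sq_le N hd (erase_mem_faces hd1 T ha)
        (mem_adjacent.2 (Finset.erase_subset _ _))
    have h1 := (integral_sq_le hd1 hF (N.jump F z)).trans
      (mul_le_mul_of_nonneg_left (Finset.sum_le_sum hval) (area_nonneg F))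
    rw [Finset.sum_const, (mem_faces.1 hF).2, nsmul_eq_mul] at h1
    refine (mul_le_mul_of_nonneg_left h1 (hinv F)).trans ?_
    rw [Finset.mul_sum, Finset.mul_sum, Finset.mul_sum]
    refine Finset.sum_le_sum fun T hT => ?_
    obtain ⟨b, hb, rfl⟩ := exists_eq_erase hF hT
    rw [hV]
    simp only [Finset.mul_sum]
    refine Finset.sum_le_sum fun a ha => ?_
    have h2 := mul_le_mul_of_nonneg_right (hM.inv_faceDiam_mul_area_le hd T hb ha)
      (mul_nonneg (show (0 : ℝ) ≤ 2 * (d + 1) * (d : ℝ) ^ 3 by positivity) (hJ0 (T.1.erase a)))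
    calc _ = _ := by ring
      _ ≤ _ := h2
      _ = _ := by rw [hW, hC]; ring
  have hCC : 0 ≤ C := by positivity
  -- Double counting: each element is met once for each of its d + 1 faces, and each face belongs to
  -- at most two elements. This multiplies C by 2(d + 1).
  calc _ ≤ ∑ F ∈ M.interiorOrDirichlet D, ∑ T ∈ M.adjacent F, C * V T :=
        Finset.sum_le_sum fun F hF => hface F (hsub hF)
    _ ≤ ∑ F ∈ M.faces, ∑ T ∈ M.adjacent F, C * V T :=
        Finset.sum_le_sum_of_subset_of_nonneg hsub fun F _ _ =>
          Finset.sum_nonneg fun T _ => mul_nonneg hCC (hV0 T)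
    _ = ∑ T : M.elements, ∑ a ∈ T.1, (d + 1) * C * W (T.1.erase a) := by
        rw [← sum_elements_erase hd1 (fun T _ => C * V T)]
        refine Finset.sum_congr rfl fun T _ => ?_
        rw [Finset.sum_const, (isSimplex T).card_eq, nsmul_eq_mul, hV, ← Finset.mul_sum]
        push_cast
        ring
    _ = ∑ F ∈ M.faces, ∑ T ∈ M.adjacent F, (d + 1) * C * W F :=
        sum_elements_erase hd1 (fun _ F => (d + 1) * C * W F)
    _ ≤ ∑ F ∈ M.faces, 2 * ((d + 1) * C * W F) := by
        refine Finset.sum_le_sum fun F hF => ?_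
        rw [Finset.sum_const, nsmul_eq_mul]
        have : ((M.adjacent F).card : ℝ) ≤ 2 := by exact_mod_cast N.card_adjacent_le hd1 hF
        exact mul_le_mul_of_nonneg_right this (mul_nonneg (by positivity) (hW0 F))
    _ = ∑ F ∈ M.interiorOrDirichlet D, 2 * ((d + 1) * C * W F) := by
        refine (Finset.sum_subset hsub fun F _ hF => ?_).symm
        simp [hW, hJ, hF]
    _ = _ := by
        rw [Finset.mul_sum]
        refine Finset.sum_congr rfl fun F hF => ?_
        simp only [hW, hJ, if_pos hF, hC]
        ring

/-- By Pythagoras the left side is A - B, with A the full jumps and B their means. From A ≤ K B one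
gets B ≥ A/(1 + K); adding 1 to K keeps the parameter at least 1. -/
theorem jumpEstimate_of_shapeRegular {σ : ℝ} (hM : M.ShapeRegular σ) :
    JumpEstimate N D (1 + 4 * (d + 1) ^ 2 * (d : ℝ) ^ 3 * σ ^ 2) := by
  intro z hz
  have hd1 : 1 ≤ d := by omega
  have hsub := interiorOrDirichlet_subset hD
  have key := hz.sum_integral_jump_sq_le N hd hD hM
  set K : ℝ := 4 * (d + 1) ^ 2 * (d : ℝ) ^ 3 * σ ^ 2 with hK
  have hK0 : 0 ≤ K := by positivity
  set A := ∑ F ∈ M.interiorOrDirichlet D, (faceDiam F)⁻¹ *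
      ∫ x, (N.jump F z : Vec d →ᵃ[ℝ] ℝ) x ^ 2 ∂(surf F) with hA
  set B := ∑ F ∈ M.interiorOrDirichlet D, (faceDiam F)⁻¹ *
        (area F * N.jump F (fun T => vmean F (z T)) ^ 2) with hB
  have hB0 : 0 ≤ B := Finset.sum_nonneg fun F _ => mul_nonneg (inv_nonneg.2 Metric.diam_nonneg)
    (mul_nonneg (area_nonneg F) (sq_nonneg _))
  have h1 : ∑ F ∈ M.interiorOrDirichlet D, (faceDiam F)⁻¹ *
      ∫ x, (N.jump F (fun T => z T x) - P0 F (fun y => N.jump F (fun T => z T y))) ^ 2 ∂(surf F)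
      = A - B := by
    rw [hA, hB, ← Finset.sum_sub_distrib]
    refine Finset.sum_congr rfl fun F hF => ?_
    rw [N.P0_jump hd1 (hsub hF), ← N.vmean_jump, ← mul_sub]
    simp only [N.jump_apply]
    rw [integral_sub_vmean_sq hd1 (hsub hF)]
  rw [h1]
  simp only [N.jump_apply]
  change A - B ≤ (1 - 1 / (1 + K)) * A
  have h2 : A ≤ (1 + K) * B := by linarith
  have h3 : A / (1 + K) ≤ B := by rw [div_le_iff₀ (by linarith)]; linarith
  have h4 : (1 - 1 / (1 + K)) * A = A - A / (1 + K) := by ring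
  linarith

end JumpEstimate

/-! ### The strengthened Cauchy–Schwarz inequality -/

section CauchySchwarz

/-- The Cauchy–Schwarz inequality for a weighted sum of `L²` scalar products over faces. -/
theorem sum_integral_inner_sq_le (hd : 1 ≤ d) {s : Finset (Finset (Vec d))} (hs : s ⊆ M.faces)
    {c : Finset (Vec d) → ℝ} (hc : ∀ F, 0 ≤ c F) {f g : Finset (Vec d) → Vec d → Vec d}
    (hf : ∀ F, Continuous (f F)) (hg : ∀ F, Continuous (g F)) :
    (∑ F ∈ s, c F * ∫ x, inner ℝ (f F x) (g F x) ∂(surf F)) ^ 2 ≤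
      (∑ F ∈ s, c F * ∫ x, inner ℝ (f F x) (f F x) ∂(surf F)) *
        ∑ F ∈ s, c F * ∫ x, inner ℝ (g F x) (g F x) ∂(surf F) := by
  set p := ∑ F ∈ s, c F * ∫ x, inner ℝ (f F x) (f F x) ∂(surf F)
  set q := ∑ F ∈ s, c F * ∫ x, inner ℝ (f F x) (g F x) ∂(surf F)
  set r := ∑ F ∈ s, c F * ∫ x, inner ℝ (g F x) (g F x) ∂(surf F)
  -- The semidefinite form at f + t g is a nonnegative quadratic in t, so its discriminant is at
  -- most 0.
  have h : ∀ t : ℝ, 0 ≤ r * (t * t) + (2 * q) * t + p := by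
    intro t
    have h1 : 0 ≤ ∑ F ∈ s, c F * ∫ x, inner ℝ (f F x + t • g F x) (f F x + t • g F x) ∂(surf F) :=
      Finset.sum_nonneg fun F _ => mul_nonneg (hc F) (integral_nonneg fun x => real_inner_self_nonneg)
    refine h1.trans (le_of_eq ?_)
    rw [Finset.sum_mul, Finset.mul_sum, Finset.sum_mul, ← Finset.sum_add_distrib,
      ← Finset.sum_add_distrib]
    refine Finset.sum_congr rfl fun F hF => ?_
    have hcf := hf F
    have hcg := hg F
    have h2 : ∀ x, inner ℝ (f F x + t • g F x) (f F x + t • g F x) =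
        inner ℝ (f F x) (f F x) + (2 * t) * inner ℝ (f F x) (g F x) +
          (t * t) * inner ℝ (g F x) (g F x) := by
      intro x
      rw [inner_add_left, inner_add_right, inner_add_right, real_inner_smul_left,
        real_inner_smul_right, real_inner_smul_right, real_inner_smul_left,
        real_inner_comm (f F x) (g F x)]
      ring
    simp_rw [h2]
    rw [integral_add, integral_add, integral_const_mul, integral_const_mul]
    · ring
    all_goals exact integrable_face hd (hs hF) (by fun_prop)
  have hdisc := discrim_le_zero h
  rw [discrim] at hdisc
  nlinarith

end CauchySchwarz

section Main

variable (hd : 1 ≤ d) {D : Finset (Finset (Vec d))} (hD : D ⊆ M.boundaryFaces)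
include hd hD

omit hd hD in
theorem penalty1_eq (mu α₁ : ℝ) (u w : M.DG (Vec d)) :
    penalty1 N D mu α₁ u w = α₁ * (2 * mu) * ∑ F ∈ M.interiorOrDirichlet D, (faceDiam F)⁻¹ *
      ∫ x, inner ℝ ((N.jump F u : Vec d →ᵃ[ℝ] Vec d) x)
        ((N.jump F w : Vec d →ᵃ[ℝ] Vec d) x) ∂(surf F) := by
  rw [penalty1]
  simp only [N.jump_apply, real_inner_smul_left, integral_const_mul]

/-- The jump estimate for vector fields, which follows by summation over the components. -/
theorem JumpEstimate.vector {ρ : ℝ} (hJ : JumpEstimate N D ρ) {z : M.DG (Vec d)} (hz : IsZ D z) :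
    ∑ F ∈ M.interiorOrDirichlet D, (faceDiam F)⁻¹ *
      ∫ x, inner ℝ ((N.jump F z : Vec d →ᵃ[ℝ] Vec d) x - N.jump F (fun T => vmean F (z T)))
        ((N.jump F z : Vec d →ᵃ[ℝ] Vec d) x - N.jump F (fun T => vmean F (z T))) ∂(surf F) ≤
    (1 - 1 / ρ) * ∑ F ∈ M.interiorOrDirichlet D, (faceDiam F)⁻¹ *
      ∫ x, inner ℝ ((N.jump F z : Vec d →ᵃ[ℝ] Vec d) x)
        ((N.jump F z : Vec d →ᵃ[ℝ] Vec d) x) ∂(surf F) := by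
  have hsub := interiorOrDirichlet_subset hD
  set pr : Fin d → Vec d →ₗ[ℝ] ℝ := fun i => (EuclideanSpace.proj i : Vec d →L[ℝ] ℝ).toLinearMap
    with hpr
  set zc : Fin d → M.DG ℝ := fun i T => (pr i).toAffineMap.comp (z T) with hzc
  have hvm : ∀ i F T, vmean F (zc i T) = pr i (vmean F (z T)) := by
    intro i F T
    simp [vmean, hzc, map_sum]
  have hzZ : ∀ i, IsZ D (zc i) := by
    intro i F hF
    rw [P0_avg hd (interiorOrNeumann_subset D hF)]
    simp only [hvm]
    rw [← map_avg, hz.avg_vmean hd hF, map_zero]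
  have hj : ∀ i F x, N.jump F (fun T => zc i T x) = (N.jump F z : Vec d →ᵃ[ℝ] Vec d) x i := by
    intro i F x
    have : ∀ T, zc i T x = pr i (z T x) := fun T => rfl
    simp only [this]
    rw [← N.map_jump, N.jump_apply]
    rfl
  have hsplit : ∀ F ∈ M.interiorOrDirichlet D, ∀ f : Vec d → Vec d, Continuous f →
      ∫ x, inner ℝ (f x) (f x) ∂(surf F) = ∑ i, ∫ x, f x i ^ 2 ∂(surf F) := by
    intro F hF f hf
    rw [← integral_finsetSum]
    · refine integral_congr_ae (Filter.Eventually.of_forall fun x => ?_)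
      simp only [real_inner_self_eq_norm_sq, EuclideanSpace.real_norm_sq_eq]
    · intro i _
      exact integrable_face hd (hsub hF) (by fun_prop)
  have hcont : ∀ F, Continuous (N.jump F z : Vec d →ᵃ[ℝ] Vec d) := fun F =>
    (N.jump F z : Vec d →ᵃ[ℝ] Vec d).continuous_of_finiteDimensional
  have hsum := Finset.sum_le_sum fun (i : Fin d) (_ : i ∈ Finset.univ) => hJ (zc i) (hzZ i)
  rw [← Finset.mul_sum, Finset.sum_comm, Finset.sum_comm (γ := Fin d)] at hsum
  simp only [← Finset.mul_sum] at hsum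
  refine le_trans (le_of_eq ?_) (hsum.trans (le_of_eq ?_))
  · refine Finset.sum_congr rfl fun F hF => ?_
    have := hcont F
    rw [hsplit F hF _ (by fun_prop)]
    congr 1
    refine Finset.sum_congr rfl fun i _ => ?_
    rw [N.P0_jump hd (hsub hF)]
    simp only [hj, hvm]
    rw [← N.map_jump]
    rfl
  · congr 1
    refine Finset.sum_congr rfl fun F hF => ?_
    rw [hsplit F hF _ (hcont F)]
    simp only [hj]

theorem penalty1_sq_le {ρ mu α₁ : ℝ} (hJ : JumpEstimate N D ρ) {z v : M.DG (Vec d)}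
    (hz : IsZ D z) (hv : IsCR N D v) :
    penalty1 N D mu α₁ z v ^ 2 ≤
      (1 - 1 / ρ) * penalty1 N D mu α₁ z z * penalty1 N D mu α₁ v v := by
  have hsub := interiorOrDirichlet_subset hD
  have hinv : ∀ F : Finset (Vec d), 0 ≤ (faceDiam F)⁻¹ := fun F => inv_nonneg.2 Metric.diam_nonneg
  have hcont : ∀ (u : M.DG (Vec d)) F, Continuous (N.jump F u : Vec d →ᵃ[ℝ] Vec d) := fun u F =>
    (N.jump F u : Vec d →ᵃ[ℝ] Vec d).continuous_of_finiteDimensional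
  have hcs := sum_integral_inner_sq_le hd hsub hinv
    (f := fun F x => (N.jump F z : Vec d →ᵃ[ℝ] Vec d) x - N.jump F (fun T => vmean F (z T)))
    (g := fun F => (N.jump F v : Vec d →ᵃ[ℝ] Vec d))
    (fun F => (hcont z F).sub continuous_const) (hcont v)
  -- The constant P_E[z] is orthogonal to [v], which has mean zero on the face. This replacement is
  -- the source of the gain over plain Cauchy–Schwarz.
  have heq : ∑ F ∈ M.interiorOrDirichlet D, (faceDiam F)⁻¹ *
      ∫ x, inner ℝ ((N.jump F z : Vec d →ᵃ[ℝ] Vec d) x - N.jump F (fun T => vmean F (z T)))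
        ((N.jump F v : Vec d →ᵃ[ℝ] Vec d) x) ∂(surf F) =
      ∑ F ∈ M.interiorOrDirichlet D, (faceDiam F)⁻¹ *
      ∫ x, inner ℝ ((N.jump F z : Vec d →ᵃ[ℝ] Vec d) x)
        ((N.jump F v : Vec d →ᵃ[ℝ] Vec d) x) ∂(surf F) := by
    refine Finset.sum_congr rfl fun F hF => ?_
    have h1 := hcont z F
    have h2 := hcont v F
    simp only [inner_sub_left]
    rw [integral_sub, integral_inner_affine hd (hsub hF), N.vmean_jump,
      hv.jump_vmean N hd hD hF, inner_zero_right, mul_zero, sub_zero]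
    all_goals exact integrable_face hd (hsub hF) (by fun_prop)
  rw [heq] at hcs
  have hvv : 0 ≤ ∑ F ∈ M.interiorOrDirichlet D, (faceDiam F)⁻¹ *
      ∫ x, inner ℝ ((N.jump F v : Vec d →ᵃ[ℝ] Vec d) x)
        ((N.jump F v : Vec d →ᵃ[ℝ] Vec d) x) ∂(surf F) :=
    Finset.sum_nonneg fun F _ => mul_nonneg (hinv F) (integral_nonneg fun x => real_inner_self_nonneg)
  have h := mul_le_mul_of_nonneg_left
    (hcs.trans (mul_le_mul_of_nonneg_right (hJ.vector N hd hD hz) hvv))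
    (sq_nonneg (α₁ * (2 * mu)))
  rw [penalty1_eq, penalty1_eq, penalty1_eq, mul_pow]
  refine h.trans (le_of_eq ?_)
  ring

omit hd hD in
theorem penalty1_self_nonneg {mu α₁ : ℝ} (hm : 0 ≤ mu) (hα : 0 ≤ α₁) (u : M.DG (Vec d)) :
    0 ≤ penalty1 N D mu α₁ u u := by
  rw [penalty1_eq]
  exact mul_nonneg (by positivity) (Finset.sum_nonneg fun F _ =>
    mul_nonneg (inv_nonneg.2 Metric.diam_nonneg) (integral_nonneg fun x => real_inner_self_nonneg))

/-- The strengthened Cauchy–Schwarz inequality, given the jump estimate and the positive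
semidefiniteness of `𝒜₀`. -/
theorem formA_sq_le {ρ lam mu α₀ α₁ : ℝ} (hρ : 1 ≤ ρ) (hJ : JumpEstimate N D ρ) (hm : 0 ≤ mu)
    (hα : 0 ≤ α₁) (hpos : ∀ u : M.DG (Vec d), 0 ≤ formA0 N D lam mu α₀ u u)
    {z v : M.DG (Vec d)} (hz : IsZ D z) (hv : IsCR N D v) :
    formA N D lam mu α₀ α₁ z v ^ 2 ≤
      (1 - 1 / ρ) * formA N D lam mu α₀ α₁ z z * formA N D lam mu α₀ α₁ v v := by
  have h0 : 0 ≤ 1 - 1 / ρ := by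
    have : 1 / ρ ≤ 1 := by rw [div_le_one (by linarith)]; exact hρ
    linarith
  have h1 : formA N D lam mu α₀ α₁ z v = penalty1 N D mu α₁ z v := by
    rw [formA, formA0_eq_zero N hd hD lam mu α₀ hz hv, zero_add]
  -- Nonnegativity of 𝒜₀ is needed only on the diagonal, to pass from the penalty to the full form.
  have hle : ∀ u : M.DG (Vec d), penalty1 N D mu α₁ u u ≤ formA N D lam mu α₀ α₁ u u := by
    intro u
    rw [formA]
    linarith [hpos u]
  rw [h1]
  refine (penalty1_sq_le N hd hD hJ hz hv).trans ?_
  have hz0 := penalty1_self_nonneg N (D := D) hm hα z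
  have hv0 := penalty1_self_nonneg N (D := D) hm hα v
  have hz1 := hle z
  have hv1 := hle v
  have hz2 := hz0.trans hz1
  gcongr

end Main

end Mesh

end ElasticityDG

end

open ElasticityDG ElasticityDG.Mesh in
theorem lemma4p1 :
    ∃ γ : ℝ → ℝ → ℝ → ℝ,
      (∀ α₀ α₁ ρ : ℝ, 0 < α₀ → 0 ≤ α₁ → 1 ≤ ρ → 0 ≤ γ α₀ α₁ ρ ∧ γ α₀ α₁ ρ < 1) ∧
      ∀ d : ℕ, (d = 2 ∨ d = 3) → ∀ σ : ℝ, 0 < σ →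
        ∃ αs : ℝ, 0 < αs ∧ ∃ ρs : ℝ, 1 ≤ ρs ∧
          ∀ (M : Mesh d), M.ShapeRegular σ →
          ∀ (N : M.Normals) (D : Finset (Finset (Vec d))), D ⊆ M.boundaryFaces →
            JumpEstimate N D ρs ∧
            ∀ α₀ α₁ lam mu : ℝ, 0 < α₀ → 0 ≤ α₁ → 0 ≤ lam → 0 < mu →
              (αs ≤ α₀ ∨ ∀ u : M.DG (Vec d), 0 ≤ formA0 N D lam mu α₀ u u) →
              ∀ ρ : ℝ, 1 ≤ ρ → JumpEstimate N D ρ →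
              ∀ z v : M.DG (Vec d), IsZ D z → IsCR N D v →
                formA N D lam mu α₀ α₁ z v ^ 2 ≤
                  γ α₀ α₁ ρ ^ 2 * formA N D lam mu α₀ α₁ z z * formA N D lam mu α₀ α₁ v v := by
  have hnn : ∀ ρ : ℝ, 1 ≤ ρ → 0 ≤ 1 - 1 / ρ := fun ρ hρ => by
    have : 1 / ρ ≤ 1 := by rw [div_le_one (by linarith)]; exact hρ
    linarith
  -- The constant depends on ρ alone; 1/ρ > 0 keeps it below 1.
  refine ⟨fun _ _ ρ => √(1 - 1 / ρ), fun _ _ ρ _ _ hρ => ⟨Real.sqrt_nonneg _, ?_⟩, ?_⟩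
  · rw [Real.sqrt_lt' one_pos]
    have : 0 < 1 / ρ := by positivity
    linarith
  intro d hd23 σ hσ
  have hd : 2 ≤ d := by omega
  have hdp : (0 : ℝ) < d := by exact_mod_cast (by omega : 0 < d)
  refine ⟨(d + 1) * d * σ, by positivity, 1 + 4 * (d + 1) ^ 2 * (d : ℝ) ^ 3 * σ ^ 2,
    le_add_of_nonneg_right (by positivity), ?_⟩
  intro M hM N D hD
  refine ⟨jumpEstimate_of_shapeRegular N hd hD hM, ?_⟩
  intro α₀ α₁ lam mu _ hα₁ hl hm hor ρ hρ hJ z v hz hv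
  have hpos : ∀ u : M.DG (Vec d), 0 ≤ formA0 N D lam mu α₀ u u := by
    rcases hor with h | h
    · exact formA0_self_nonneg N hd hσ hM hD hl hm h
    · exact h
  rw [Real.sq_sqrt (hnn ρ hρ)]
  exact formA_sq_le N (by omega) hD hρ hJ hm.le hα₁ hpos hz hv
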